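/- **Setting.** Let $\mathcal G=(V,E)$ be a finite connected undirected simple graph, write $i\sim j$ when $i,j\in V$ are neighbours, let $\ell=(\ell_v)_{v\in V}$ be positive real numbers and $\ell_*:=\min_{v\in V}\ell_v$. Let $w:[\ell_*,\infty)\to(0,\infty)$ be non-decreasing and differentiable, and suppose that there are constants $\kappa>1$ and $\alpha>1$ such that $\kappa^{-1}t^{\alpha}\le w(t)\le\kappa t^{\alpha}$ for all $t\ge \ell_*$ (so that $1/w$ is integrable on $[\ell_*,\infty)$). Let $\mathbf X=(X_t)_{t\ge 0}$ be a vertex-reinforced jump process $\mathrm{VRJP}(\ell,w)$ on $\mathcal G$, with an arbitrary, possibly random, starting point. This means that $\mathbf X$ is almost surely a right-continuous $V$-valued process which moves by jumps between neighbours, with finitely many jumps in each bounded time interval, and which, given its past up to time $t$, jumps to a neighbour $j$ of $X_t$ at rate $w(L(j,t))$, where $$L(v,t):=\ell_v+\int_0^t \mathbf 1_{\{X_s=v\}}\,ds .$$ Precisely: let $\tau_n$ be the time of the $n$-th jump ($\tau_0=0$, and $\tau_n=\infty$ if there are fewer than $n$ jumps), $Y_n$ the position after the $n$-th jump ($Y_0=X_0$),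 and $T_n$ the holding time between the $n$-th and the $(n+1)$-st jump. Then for all $n\ge0$, $j\in V$ and $s\ge 0$, almost surely, $$\mathbb P\big(T_n\le s,\ Y_{n+1}=j\,\big|\,Y_0,\dots,Y_n,T_0,\dots,T_{n-1}\big)=\int_0^s \mathbf 1_{\{j\sim Y_n\}}\,w(L(j,\tau_n))\,e^{-R_nu}\,du,\qquad R_n:=\sum_{k\sim Y_n}w(L(k,\tau_n)).$$ (If $V$ has only one vertex, there are no jumps.) For $U\subset V$ put $L(U,t):=\sum_{v\in U}L(v,t)$. Let $V^*:=\{v\in V:\lim_{t\to\infty}L(v,t)=\infty\}$, and call the connected components of the subgraph of $\mathcal G$ induced on $V^*$ *clusters*. Let $J$ be the (random) number of clusters, and for each $t$ order the clusters as $\mathcal C_1(t),\dots,\mathcal C_J(t)$ with $L(\mathcal C_1(t),t)\ge\dots\ge L(\mathcal C_J(t),t)$, so that $\mathcal C_1(t)$ has the largest local time at time $t$ and $\mathcal C_J(t)$ the smallest. **Proposition 5.8.** Almost surely, $$\liminf_{t\to\infty}\frac{L(\mathcal C_J(t),t)}{L(\mathcal C_1(t),t)}>0 .$$ -/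

import Mathlib

open MeasureTheory Filter Set
open scoped NNReal ENNReal

noncomputable section

namespace VRJP

variable {V : Type*} [Fintype V]

/-- The rate of a jump from `i` to `j` when the current local times are `z`:
it is `w (z j)` if `j` is a neighbour of `i`, and `0` otherwise. -/
def jumpRate (G : SimpleGraph V) (w : ℝ → ℝ) (z : V → ℝ) (i j : V) : ℝ :=
  open Classical in if G.Adj i j then w (z j) else 0

/-- The total rate at which a walk at `i` leaves `i` when the current local times are `z`. -/
def exitRate (G : SimpleGraph V) (w : ℝ → ℝ) (z : V → ℝ) (i : V) : ℝ :=
  ∑ j, jumpRate G w z i j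

/-- The time of the `n`-th jump, when `T k` is the time spent between the `k`-th and the
`(k+1)`-st jump. It is `∞` if there are fewer than `n` jumps. -/
def jumpTime (T : ℕ → ℝ≥0∞) (n : ℕ) : ℝ≥0∞ := ∑ k ∈ Finset.range n, T k

/-- The local times at the time of the `n`-th jump, for initial local times `ℓ`, successive
positions `y` and successive holding times `T`. -/
def jumpLocalTime (ℓ : V → ℝ) (y : ℕ → V) (T : ℕ → ℝ≥0∞) (n : ℕ) (v : V) : ℝ :=
  open Classical in ℓ v + ∑ k ∈ Finset.range n, if y k = v then (T k).toReal else 0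

/-- The past up to and including the `n`-th jump: the sigma-algebra generated by the positions
`Y 0, …, Y n` and the holding times `T 0, …, T (n - 1)`. -/
@[reducible] def past {Ω : Type*} [MeasurableSpace V] (Y : ℕ → Ω → V) (T : ℕ → Ω → ℝ≥0∞) (n : ℕ) :
    MeasurableSpace Ω :=
  (⨆ k ∈ Finset.range (n + 1), MeasurableSpace.comap (Y k) inferInstance) ⊔
    ⨆ k ∈ Finset.range n, MeasurableSpace.comap (T k) inferInstance

/-- `X` is a vertex-reinforced jump process on `G` with initial local times `ℓ` and reinforcement
function `w`. It has successive positions `Y n` and holding times `T n` such that almost surely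
`X` equals `Y n` on the interval from the `n`-th jump (included) to the `(n+1)`-st jump
(excluded), these intervals cover `[0, ∞)`, and, conditionally on the past up to the `n`-th jump,
a jump to a neighbour `j` of the current position occurs at rate `w` of the local time of `j`.
The local times of the neighbours of the current position do not change before the next jump, so
this means that, with `r j` the rate of a jump to `j` and `r` the sum of the `r j`, the
conditional probability that the next jump occurs within time `s` and is to `j` is the integral of
`r j * exp (- r * u)` over `u ∈ [0, s]`. (On a one-vertex graph all rates vanish and the first
holding time is infinite.) The initial position may be random. -/
structure IsVRJP {Ω : Type*} [MeasurableSpace Ω] [MeasurableSpace V] (G : SimpleGraph V)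
    (ℓ : V → ℝ) (w : ℝ → ℝ) (P : Measure Ω) (X : ℝ≥0 → Ω → V) : Prop where
  exists_jumps : ∃ (Y : ℕ → Ω → V) (T : ℕ → Ω → ℝ≥0∞),
    (∀ n, Measurable (Y n)) ∧ (∀ n, Measurable (T n)) ∧
    (∀ᵐ ω ∂P, ∀ t : ℝ≥0, ∃ n, jumpTime (fun k => T k ω) n ≤ t ∧
      (t : ℝ≥0∞) < jumpTime (fun k => T k ω) (n + 1) ∧ X t ω = Y n ω) ∧
    ∀ (n : ℕ) (j : V) (s : ℝ≥0),
      P[({ω | T n ω ≤ s ∧ Y (n + 1) ω = j}.indicator 1 : Ω → ℝ) | past Y T n] =ᵐ[P] fun ω =>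
        let z : V → ℝ := jumpLocalTime ℓ (fun k => Y k ω) (fun k => T k ω) n
        ∫ u in (0 : ℝ)..s, jumpRate G w z (Y n ω) j * Real.exp (-exitRate G w z (Y n ω) * u)

/-- The local time `L(v, t) = ℓ v + ∫₀ᵗ 1_{x s = v} ds` of a path `x`. -/
def localTime (ℓ : V → ℝ) (x : ℝ≥0 → V) (v : V) (t : ℝ≥0) : ℝ :=
  ℓ v + ∫ s in (0 : ℝ)..t, {s : ℝ | x s.toNNReal = v}.indicator 1 s

/-- The local time `L(U, t) = ∑ v ∈ U, L(v, t)` of a set `U` of vertices. -/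
def setLocalTime (ℓ : V → ℝ) (x : ℝ≥0 → V) (U : Set V) (t : ℝ≥0) : ℝ :=
  ∑ v, U.indicator (fun v => localTime ℓ x v t) v

/-- The set `V*` of the vertices with unbounded local time. -/
def unboundedVertices (ℓ : V → ℝ) (x : ℝ≥0 → V) : Set V :=
  {v | Tendsto (localTime ℓ x v) atTop atTop}

/-- The clusters: the connected components of the subgraph induced on `V*`. -/
abbrev Cluster (G : SimpleGraph V) (ℓ : V → ℝ) (x : ℝ≥0 → V) : Type _ :=
  (G.induce (unboundedVertices ℓ x)).ConnectedComponent

/-- The local time of a cluster at time `t`. -/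
def clusterLocalTime (G : SimpleGraph V) (ℓ : V → ℝ) (x : ℝ≥0 → V) (C : Cluster G ℓ x)
    (t : ℝ≥0) : ℝ :=
  setLocalTime ℓ x (Subtype.val '' C.supp) t

/-- The local time at time `t` of the cluster which has the largest local time at time `t`. -/
def largestClusterLocalTime (G : SimpleGraph V) (ℓ : V → ℝ) (x : ℝ≥0 → V) (t : ℝ≥0) : ℝ :=
  ⨆ C : Cluster G ℓ x, clusterLocalTime G ℓ x C t

/-- The local time at time `t` of the cluster which has the smallest local time at time `t`. -/
def smallestClusterLocalTime (G : SimpleGraph V) (ℓ : V → ℝ) (x : ℝ≥0 → V) (t : ℝ≥0) : ℝ :=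
  ⨅ C : Cluster G ℓ x, clusterLocalTime G ℓ x C t

end VRJP

end

/-!
Let `U` be a set of vertices, `B` its complement, and suppose that exactly the local times on `U`
grow to infinity. If the local times `z` were frozen, the walk would be reversible with respect to
the weights `w (z v)`, so that all the quantities `∫ 1 / w` over `[ℓ v, L(v, t)]` would grow at the
same rate. For the true process this survives as an inequality in mean. Let `φ` be the potential of
the unit current from `s` to `u` in the network with conductances `w (z i) * w (z j)`. The generator
of the walk maps `φ` to `1_u / w (z u) - 1_s / w (z s)`, hence `φ` at the position plus the growth of
`∫ 1 / w` for `s`, minus that for `u`, is a martingale up to the change of `φ` in time. While the walk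
is at `i`, only the weight of `i` changes, and only the value `φ i` matters; raising the weight from
`q` to `a` raises `φ i` by at most `1 / q - 1 / a` times a bounded factor (`potential_update_le`), and
these errors telescope. If `s` has the smallest local time in `U`, the total error is
`O (1 / w (L s))`, provided that `s` and `u` are joined by edges that meet `U`
(`HasJumpLaw.setLIntegral_invMeasure_Ioi_le`).

On the event that `L s` grows to infinity, `∫ 1 / w` for `s` still grows by the full tail from `L s`,
which is of order `(L s) ^ (1 - α)`. When `L s` is large and much smaller than `L u`, this is much
more than both the tail from `L u` and the error. So at such times the conditional probability that
all local times on `U` grow to infinity, while those on `B` stay bounded, is at most `1 / 2`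
(`HasJumpLaw.condExp_localizationEvent_le`). By Lévy's zero-one law, on this event such times
are bounded, i.e. the local times on `U` are comparable (`HasJumpLaw.ae_comparable`).

That any two vertices of `U` are joined by edges meeting `U` follows from a Borel-Cantelli argument
(`HasJumpLaw.ae_eventually_edgesMeeting`): after a jump from `v` to a vertex of `B`, the walk jumps
on inside `B` with probability `O (1 / w (L v))`, and the sum of these probabilities is controlled
by `∫ 1 / w < ∞`.
-/

noncomputable section

namespace VRJP

open scoped Classical

/-! ### Potentials and effective resistances -/

section Potential

variable {V : Type*} [Fintype V]

/-- The conductance `q i * q j` of an edge between `i` and `j`, and `0` if there is no edge. -/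
def conductance (G : SimpleGraph V) (q : V → ℝ) (i j : V) : ℝ :=
  if G.Adj i j then q i * q j else 0

/-- The net current out of `i` for the potential `φ`, i.e. the weighted Laplacian of `φ`. -/
def netCurrent (G : SimpleGraph V) (q φ : V → ℝ) (i : V) : ℝ :=
  ∑ j, conductance G q i j * (φ i - φ j)

/-- The weighted Laplacian with an extra unit conductance from `u` to the ground, which makes it
invertible. -/
def groundedLaplacian (G : SimpleGraph V) (q : V → ℝ) (u : V) : Matrix V V ℝ :=
  Matrix.diagonal (fun i => ∑ k, conductance G q i k + if i = u then 1 else 0) -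
    Matrix.of (conductance G q)

/-- The potential, normalised to vanish at `u`, of the unit current from `s` to `u`. -/
def potential (G : SimpleGraph V) (q : V → ℝ) (s u : V) : V → ℝ :=
  (groundedLaplacian G q u)⁻¹.mulVec (Pi.single s 1 - Pi.single u 1)

variable {G : SimpleGraph V} {q : V → ℝ}

omit [Fintype V] in
lemma conductance_comm (i j : V) : conductance G q i j = conductance G q j i := by
  simp only [conductance, G.adj_comm i j, mul_comm]

omit [Fintype V] in
lemma conductance_nonneg (hq : ∀ v, 0 < q v) (i j : V) : 0 ≤ conductance G q i j := by
  unfold conductance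
  split_ifs
  · exact (mul_pos (hq i) (hq j)).le
  · exact le_rfl

lemma sum_mul_netCurrent (φ ψ : V → ℝ) :
    ∑ i, ψ i * netCurrent G q φ i =
      (∑ i, ∑ j, conductance G q i j * ((ψ i - ψ j) * (φ i - φ j))) / 2 := by
  have h1 : ∑ i, ψ i * netCurrent G q φ i =
      ∑ i, ∑ j, conductance G q i j * (ψ i * (φ i - φ j)) := by
    refine Finset.sum_congr rfl fun i _ => ?_
    rw [netCurrent, Finset.mul_sum]
    exact Finset.sum_congr rfl fun j _ => by ring
  have h2 : ∑ i, ψ i * netCurrent G q φ i =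
      ∑ i, ∑ j, conductance G q i j * (- ψ j * (φ i - φ j)) := by
    rw [h1, Finset.sum_comm]
    refine Finset.sum_congr rfl fun i _ => Finset.sum_congr rfl fun j _ => ?_
    rw [conductance_comm]
    ring
  rw [eq_div_iff two_ne_zero, mul_two]
  nth_rw 1 [h1]
  rw [h2, ← Finset.sum_add_distrib]
  refine Finset.sum_congr rfl fun i _ => ?_
  rw [← Finset.sum_add_distrib]
  exact Finset.sum_congr rfl fun j _ => by ring

lemma sum_netCurrent (φ : V → ℝ) : ∑ i, netCurrent G q φ i = 0 := by
  have := sum_mul_netCurrent (G := G) (q := q) φ 1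
  simpa using this

lemma sum_mul_netCurrent_comm (φ ψ : V → ℝ) :
    ∑ i, ψ i * netCurrent G q φ i = ∑ i, φ i * netCurrent G q ψ i := by
  rw [sum_mul_netCurrent, sum_mul_netCurrent]
  congr 1
  exact Finset.sum_congr rfl fun i _ => Finset.sum_congr rfl fun j _ => by ring

lemma groundedLaplacian_mulVec (u : V) (φ : V → ℝ) (i : V) :
    (groundedLaplacian G q u).mulVec φ i = netCurrent G q φ i + if i = u then φ u else 0 := by
  rw [groundedLaplacian, Matrix.sub_mulVec, Pi.sub_apply, Matrix.mulVec_diagonal, netCurrent]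
  simp only [Matrix.mulVec, dotProduct, Matrix.of_apply, mul_sub, Finset.sum_sub_distrib]
  rw [add_mul, Finset.sum_mul]
  split_ifs with h
  · subst h; ring
  · ring

omit [Fintype V] in
/-- A subset that meets no edge to its complement is trivial in a connected graph. -/
lemma eq_univ_of_forall_adj (hG : G.Connected) (D : Set V) {a : V} (ha : a ∈ D)
    (hD : ∀ i ∈ D, ∀ j, G.Adj i j → j ∈ D) (b : V) : b ∈ D := by
  obtain ⟨p⟩ := hG.preconnected a b
  induction p with
  | nil => exact ha
  | cons h p ih => exact ih (hD _ ha _ h)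

lemma isUnit_groundedLaplacian (hG : G.Connected) (hq : ∀ v, 0 < q v) (u : V) :
    IsUnit (groundedLaplacian G q u) := by
  rw [← Matrix.mulVec_injective_iff_isUnit]
  rw [← Matrix.coe_mulVecLin, injective_iff_map_eq_zero]
  intro φ hφ
  have hφ' : ∀ i, netCurrent G q φ i + (if i = u then φ u else 0) = 0 := fun i => by
    rw [← groundedLaplacian_mulVec]
    exact congrFun hφ i
  have hu : φ u = 0 := by
    have : ∑ i, (netCurrent G q φ i + if i = u then φ u else 0) = 0 :=
      Finset.sum_eq_zero fun i _ => hφ' i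
    rwa [Finset.sum_add_distrib, sum_netCurrent, zero_add,
      Finset.sum_ite_eq' Finset.univ u (fun _ => φ u), if_pos (Finset.mem_univ _)] at this
  have hnet : ∀ i, netCurrent G q φ i = 0 := fun i => by simpa [hu] using hφ' i
  have hE : ∑ i, ∑ j, conductance G q i j * ((φ i - φ j) * (φ i - φ j)) = 0 := by
    have := sum_mul_netCurrent (G := G) (q := q) φ φ
    simp only [hnet, mul_zero, Finset.sum_const_zero] at this
    linarith
  have hnn : ∀ i j, 0 ≤ conductance G q i j * ((φ i - φ j) * (φ i - φ j)) := fun i j =>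
    mul_nonneg (conductance_nonneg hq i j) (mul_self_nonneg _)
  have hadj : ∀ i j, G.Adj i j → φ i = φ j := by
    intro i j hij
    have h1 := (Finset.sum_eq_zero_iff_of_nonneg
      fun i _ => Finset.sum_nonneg fun j _ => hnn i j).1 hE i (Finset.mem_univ i)
    have h2 := (Finset.sum_eq_zero_iff_of_nonneg fun j _ => hnn i j).1 h1 j (Finset.mem_univ j)
    rw [conductance, if_pos hij] at h2
    have h3 : (φ i - φ j) * (φ i - φ j) = 0 :=
      (mul_eq_zero.1 h2).resolve_left (mul_pos (hq i) (hq j)).ne'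
    have := mul_self_eq_zero.1 h3
    linarith
  funext b
  exact eq_univ_of_forall_adj hG {v | φ v = 0} (a := u) hu
    (fun i hi j hij => by rw [mem_ofPred_eq, ← hadj i j hij]; exact hi) b

variable (hG : G.Connected) (hq : ∀ v, 0 < q v)
include hG hq

lemma potential_spec (s u : V) :
    potential G q s u u = 0 ∧ ∀ i, netCurrent G q (potential G q s u) i =
      (if i = s then 1 else 0) - if i = u then 1 else 0 := by
  have hM : ∀ i, netCurrent G q (potential G q s u) i +
      (if i = u then potential G q s u u else 0) =
      (if i = s then 1 else 0) - if i = u then 1 else 0 := by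
    intro i
    rw [← groundedLaplacian_mulVec, potential, Matrix.mulVec_mulVec, Matrix.mul_nonsing_inv _
      ((Matrix.isUnit_iff_isUnit_det _).1 (isUnit_groundedLaplacian hG hq u)), Matrix.one_mulVec]
    simp [Pi.single_apply]
  have hu : potential G q s u u = 0 := by
    have : ∑ i, (netCurrent G q (potential G q s u) i +
        if i = u then potential G q s u u else 0) =
        ∑ i, ((if i = s then (1 : ℝ) else 0) - if i = u then 1 else 0) :=
      Finset.sum_congr rfl fun i _ => hM i
    rw [Finset.sum_add_distrib, sum_netCurrent, zero_add,
      Finset.sum_ite_eq' Finset.univ u (fun _ => potential G q s u u),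
      if_pos (Finset.mem_univ _)] at this
    simpa using this
  refine ⟨hu, fun i => ?_⟩
  simpa [hu] using hM i

omit hG hq in
/-- The current out of a set is the sum of the currents across its boundary. -/
lemma sum_netCurrent_eq_boundary (φ : V → ℝ) (D : Set V) :
    ∑ i, (if i ∈ D then netCurrent G q φ i else 0) =
      ∑ i, ∑ j, if i ∈ D ∧ j ∉ D then conductance G q i j * (φ i - φ j) else 0 := by
  have h := sum_mul_netCurrent (G := G) (q := q) φ (fun i => if i ∈ D then 1 else 0)
  simp only [ite_mul, one_mul, zero_mul] at h
  rw [h, div_eq_iff two_ne_zero, mul_two]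
  have hswap : ∑ i, ∑ j, (if i ∈ D ∧ j ∉ D then conductance G q i j * (φ i - φ j) else 0) =
      ∑ i, ∑ j, if j ∈ D ∧ i ∉ D then conductance G q i j * (φ j - φ i) else 0 := by
    rw [Finset.sum_comm]
    refine Finset.sum_congr rfl fun i _ => Finset.sum_congr rfl fun j _ => ?_
    rw [conductance_comm]
  nth_rw 2 [hswap]
  rw [← Finset.sum_add_distrib]
  refine Finset.sum_congr rfl fun i _ => ?_
  rw [← Finset.sum_add_distrib]
  refine Finset.sum_congr rfl fun j _ => ?_
  by_cases hi : i ∈ D <;> by_cases hj : j ∈ D <;> simp [hi, hj]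

/-- Across an upper level set of the potential all currents flow outwards, so that none of them
exceeds the current produced inside. -/
lemma conductance_mul_le_of_levelSet (s u : V) {c : ℝ} {D : Set V}
    (hD : ∀ i ∈ D, ∀ j, j ∉ D → potential G q s u j ≤ potential G q s u i)
    {i j : V} (hi : i ∈ D) (hj : j ∉ D) (hc : (if s ∈ D then 1 else 0) - (if u ∈ D then 1 else 0) ≤ c) :
    conductance G q i j * (potential G q s u i - potential G q s u j) ≤ c := by
  set φ := potential G q s u
  have h := sum_netCurrent_eq_boundary (G := G) (q := q) φ D
  have h1 : ∑ i, (if i ∈ D then netCurrent G q φ i else 0) =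
      (if s ∈ D then 1 else 0) - if u ∈ D then 1 else 0 := by
    have : ∀ i, (if i ∈ D then netCurrent G q φ i else 0) =
        (if i = s then (if s ∈ D then 1 else 0) else 0) -
          if i = u then (if u ∈ D then 1 else 0) else 0 := by
      intro i
      rw [(potential_spec hG hq s u).2 i]
      by_cases h1 : i = s <;> by_cases h2 : i = u <;> by_cases h3 : i ∈ D <;> simp_all
    rw [Finset.sum_congr rfl fun i _ => this i, Finset.sum_sub_distrib]
    simp
  have hnn : ∀ i j, 0 ≤ if i ∈ D ∧ j ∉ D then conductance G q i j * (φ i - φ j) else 0 := by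
    intro i j
    split_ifs with hij
    · exact mul_nonneg (conductance_nonneg hq i j) (sub_nonneg.2 (hD i hij.1 j hij.2))
    · exact le_rfl
  have h2 : (if i ∈ D ∧ j ∉ D then conductance G q i j * (φ i - φ j) else 0) ≤
      ∑ j, if i ∈ D ∧ j ∉ D then conductance G q i j * (φ i - φ j) else 0 :=
    Finset.single_le_sum (fun j _ => hnn i j) (Finset.mem_univ j)
  have h3 : (∑ j, if i ∈ D ∧ j ∉ D then conductance G q i j * (φ i - φ j) else 0) ≤
      ∑ i, ∑ j, if i ∈ D ∧ j ∉ D then conductance G q i j * (φ i - φ j) else 0 :=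
    Finset.single_le_sum (f := fun i => ∑ j, if i ∈ D ∧ j ∉ D then conductance G q i j * (φ i - φ j) else 0)
      (fun i _ => Finset.sum_nonneg fun j _ => hnn i j) (Finset.mem_univ i)
  rw [if_pos ⟨hi, hj⟩] at h2
  linarith

/-- The current through an edge is at most the total current. -/
lemma potential_sub_le_inv (s u : V) {i j : V} (hij : G.Adj i j) :
    potential G q s u i - potential G q s u j ≤ (q i * q j)⁻¹ := by
  have hpos := mul_pos (hq i) (hq j)
  rcases le_or_gt (potential G q s u i) (potential G q s u j) with h | h
  · exact (sub_nonpos.2 h).trans (inv_pos.2 hpos).le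
  · have := conductance_mul_le_of_levelSet hG hq s u (c := 1)
      (D := {k | potential G q s u i ≤ potential G q s u k})
      (fun k hk l hl => (not_le.1 hl).le.trans hk) (i := i) (j := j) (by simp) (by simpa using h)
      (by split_ifs <;> norm_num)
    rw [conductance, if_pos hij] at this
    rw [← mul_one (q i * q j)⁻¹, inv_mul_eq_div, le_div_iff₀ hpos, mul_comm]
    exact this

omit hq in
lemma exists_adj_boundary {D : Set V} {a b : V} (ha : a ∈ D) (hb : b ∉ D) :
    ∃ i ∈ D, ∃ j, j ∉ D ∧ G.Adj i j := by
  by_contra! h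
  exact hb (eq_univ_of_forall_adj hG D ha (fun i hi j hij => by
    by_contra hj; exact h i hi j hj hij) b)

lemma potential_le (s u i : V) : potential G q s u i ≤ potential G q s u s := by
  by_contra! h
  set D : Set V := {k | potential G q s u i ≤ potential G q s u k} with hDdef
  have hs : s ∉ D := by simpa [hDdef] using h
  obtain ⟨a, ha, b, hb, hab⟩ := exists_adj_boundary hG (D := D) (a := i) (by simp [hDdef]) hs
  have := conductance_mul_le_of_levelSet hG hq s u (c := 0) (D := D)
    (fun k hk l hl => (not_le.1 hl).le.trans hk) ha hb (by rw [if_neg hs]; split_ifs <;> norm_num)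
  rw [conductance, if_pos hab] at this
  have h1 : potential G q s u b < potential G q s u a := (not_le.1 hb).trans_le ha
  nlinarith [mul_pos (mul_pos (hq a) (hq b)) (sub_pos.2 h1)]

lemma potential_nonneg (s u i : V) : 0 ≤ potential G q s u i := by
  by_contra! h
  set D : Set V := {k | potential G q s u i < potential G q s u k} with hDdef
  have hu : u ∈ D := by simpa [hDdef, (potential_spec hG hq s u).1] using h
  obtain ⟨a, ha, b, hb, hab⟩ := exists_adj_boundary hG (D := D) (b := i) hu (by simp [hDdef])
  have := conductance_mul_le_of_levelSet hG hq s u (c := 0) (D := D)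
    (fun k hk l hl => (not_lt.1 hl).trans (le_of_lt hk)) ha hb
    (by rw [if_pos hu]; split_ifs <;> norm_num)
  rw [conductance, if_pos hab] at this
  have h1 : potential G q s u b < potential G q s u a := (not_lt.1 hb).trans_lt ha
  nlinarith [mul_pos (mul_pos (hq a) (hq b)) (sub_pos.2 h1)]

end Potential

section Variation

variable {V : Type*} [Fintype V]

/-- The factor in the bound for the growth of the potential at `i` when the weight of `i` grows:
`q i` times the sum of the potential drops along the edges that carry current into `i`. -/
def inflow (G : SimpleGraph V) (q : V → ℝ) (s u i : V) : ℝ :=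
  q i * ∑ j, if G.Adj i j then max 0 (potential G q s u j - potential G q s u i) else 0

variable {G : SimpleGraph V} {q : V → ℝ} (hG : G.Connected) (hq : ∀ v, 0 < q v)
include hG hq

/-- Raising the weight of `i` raises the potential at `i` only slightly. If `g` is the potential
of the unit current from `i` to `u` for the new weights, the increase is
`- ∑ j, δ * q j * (g i - g j) * (φ i - φ j)` with `δ` the increase of the weight, and
`0 ≤ g i - g j ≤ (a * q j)⁻¹`, so that only the `j` with `φ j > φ i` contribute. -/
lemma potential_update_le (s u i : V) {a : ℝ} (ha : q i ≤ a) :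
    potential G (Function.update q i a) s u i ≤
      potential G q s u i + ((q i)⁻¹ - a⁻¹) * inflow G q s u i := by
  set q' := Function.update q i a with hq'def
  have hapos : 0 < a := (hq i).trans_le ha
  have hq' : ∀ v, 0 < q' v := by
    intro v
    by_cases hv : v = i
    · subst hv; simpa [hq'def] using hapos
    · simpa [hq'def, hv] using hq v
  have hq'i : q' i = a := by simp [hq'def]
  have hq'j : ∀ j, j ≠ i → q' j = q j := fun j hj => by simp [hq'def, hj]
  set φ := potential G q s u
  set φ' := potential G q' s u
  set g := potential G q' i u
  obtain ⟨hφu, hφ⟩ := potential_spec hG hq s u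
  obtain ⟨hφ'u, hφ'⟩ := potential_spec hG hq' s u
  obtain ⟨hgu, hg⟩ := potential_spec hG hq' i u
  have key : φ' i - φ i = - ∑ j, if G.Adj i j then (a - q i) * q j * ((g i - g j) * (φ i - φ j)) else 0 := by
    have e1 : ∑ k, φ' k * netCurrent G q' g k = φ' i := by
      simp [g, hg, mul_sub, Finset.sum_sub_distrib, φ', hφ'u]
    have e2 : ∑ k, φ k * netCurrent G q' g k = φ i := by
      simp [g, hg, mul_sub, Finset.sum_sub_distrib, φ, hφu]
    have e3 : ∑ k, g k * netCurrent G q' φ' k = ∑ k, g k * netCurrent G q φ k := by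
      simp only [φ, φ', hφ, hφ']
    rw [sum_mul_netCurrent_comm] at e1 e2
    rw [e1, sum_mul_netCurrent] at e3
    rw [sum_mul_netCurrent] at e2
    have e4 : ∀ k, (∑ j, conductance G q k j * ((g k - g j) * (φ k - φ j))) -
        (∑ j, conductance G q' k j * ((g k - g j) * (φ k - φ j))) =
        (if k = i then - ∑ j, (if G.Adj i j then (a - q i) * q j * ((g i - g j) * (φ i - φ j)) else 0) else 0)
        - (if G.Adj i k then (a - q i) * q k * ((g i - g k) * (φ i - φ k)) else 0) := by
      intro k
      rw [← Finset.sum_sub_distrib]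
      by_cases hk : k = i
      · subst hk
        rw [if_pos rfl, if_neg (G.irrefl), sub_zero, ← Finset.sum_neg_distrib]
        refine Finset.sum_congr rfl fun j _ => ?_
        unfold conductance
        split_ifs with hkj
        · rw [hq'i, hq'j j (G.ne_of_adj hkj).symm]; ring
        · simp
      · rw [if_neg hk, zero_sub, Finset.sum_eq_single i]
        · unfold conductance
          rw [G.adj_comm k i]
          split_ifs
          · rw [hq'i, hq'j k hk]; ring
          · simp
        · intro j _ hj
          unfold conductance
          rw [hq'j k hk, hq'j j hj, sub_self]
        · simp
    have e5 := Finset.sum_congr rfl fun k (_ : k ∈ Finset.univ) => e4 k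
    rw [Finset.sum_sub_distrib, Finset.sum_sub_distrib, Finset.sum_ite_eq' Finset.univ i,
      if_pos (Finset.mem_univ _)] at e5
    linarith
  have hbound : φ' i - φ i ≤ ((q i)⁻¹ - a⁻¹) * inflow G q s u i := by
    rw [key, inflow, ← Finset.sum_neg_distrib, Finset.mul_sum, Finset.mul_sum]
    refine Finset.sum_le_sum fun j _ => ?_
    split_ifs with hij
    · have hji : j ≠ i := (G.ne_of_adj hij).symm
      have g1 : 0 ≤ g i - g j := sub_nonneg.2 (potential_le hG hq' i u j)
      have g2 : g i - g j ≤ (a * q j)⁻¹ := by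
        have := potential_sub_le_inv hG hq' i u hij
        rwa [hq'i, hq'j j hji] at this
      set m := max 0 (φ j - φ i)
      have m0 : 0 ≤ m := le_max_left _ _
      have m1 : φ j - φ i ≤ m := le_max_right _ _
      have hqi := hq i
      have hqj := hq j
      have e : ((q i)⁻¹ - a⁻¹) * (q i * m) = (a - q i) * q j * ((a * q j)⁻¹ * m) := by
        field_simp
      rw [e, ← mul_neg]
      refine mul_le_mul_of_nonneg_left ?_ (mul_nonneg (sub_nonneg.2 ha) hqj.le)
      calc -((g i - g j) * (φ i - φ j)) = (g i - g j) * (φ j - φ i) := by ring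
        _ ≤ (g i - g j) * m := mul_le_mul_of_nonneg_left m1 g1
        _ ≤ (a * q j)⁻¹ * m := mul_le_mul_of_nonneg_right g2 m0
    · simp
  linarith

omit hG in
lemma inflow_nonneg (s u i : V) : 0 ≤ inflow G q s u i :=
  mul_nonneg (hq i).le (Finset.sum_nonneg fun j _ => by
    split_ifs
    · exact le_max_left _ _
    · exact le_rfl)

lemma inflow_le_card_div (s u i : V) {c : ℝ} (hc : 0 < c) (hcq : ∀ v, c ≤ q v) :
    inflow G q s u i ≤ Fintype.card V / c := by
  have hqi := hq i
  have h : ∀ j, (if G.Adj i j then max 0 (potential G q s u j - potential G q s u i) else 0) ≤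
      (q i * c)⁻¹ := by
    intro j
    have hpos : 0 ≤ (q i * c)⁻¹ := by positivity
    split_ifs with hij
    · refine max_le hpos ((potential_sub_le_inv hG hq s u hij.symm).trans ?_)
      rw [mul_comm (q j)]
      gcongr
      exact hcq j
    · exact hpos
  calc inflow G q s u i ≤ q i * ∑ _j : V, (q i * c)⁻¹ :=
        mul_le_mul_of_nonneg_left (Finset.sum_le_sum fun j _ => h j) hqi.le
    _ = Fintype.card V / c := by
        rw [Finset.sum_const, nsmul_eq_mul, Finset.card_univ]
        field_simp

lemma inflow_le_mul (s u i : V) :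
    inflow G q s u i ≤ q i * (Fintype.card V * potential G q s u s) := by
  have h : ∀ j, (if G.Adj i j then max 0 (potential G q s u j - potential G q s u i) else 0) ≤
      potential G q s u s := by
    intro j
    have h0 := potential_nonneg hG hq s u s
    split_ifs with hij
    · refine max_le h0 ?_
      linarith [potential_nonneg hG hq s u i, potential_le hG hq s u j]
    · exact h0
  refine mul_le_mul_of_nonneg_left ((Finset.sum_le_sum fun j _ => h j).trans ?_) (hq i).le
  rw [Finset.sum_const, nsmul_eq_mul, Finset.card_univ]

omit hG hq in
/-- The edges of `G` with at least one endpoint in `U`. -/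
def edgesMeeting (G : SimpleGraph V) (U : Set V) : SimpleGraph V where
  Adj i j := G.Adj i j ∧ (i ∈ U ∨ j ∈ U)
  symm := ⟨fun _ _ h => ⟨h.1.symm, h.2.symm⟩⟩
  loopless := ⟨fun _ h => G.irrefl h.1⟩

/-- If `s` and `u` are joined by edges meeting `U`, the effective resistance between them is small
as soon as the weights on `U` are large. -/
lemma potential_le_card_div {U : Set V} {s u : V} (hsu : (edgesMeeting G U).Reachable s u)
    {c μ : ℝ} (hc : 0 < c) (hcq : ∀ v, c ≤ q v) (hμ : 0 < μ) (hμq : ∀ v ∈ U, μ ≤ q v) :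
    potential G q s u s ≤ Fintype.card V / (c * μ) := by
  have hedge : ∀ i j, (edgesMeeting G U).Adj i j →
      potential G q s u i - potential G q s u j ≤ (c * μ)⁻¹ := by
    intro i j hij
    refine (potential_sub_le_inv hG hq s u hij.1).trans ?_
    rcases hij.2 with h | h
    · rw [mul_comm (q i)]
      exact inv_anti₀ (mul_pos hc hμ) (mul_le_mul (hcq j) (hμq i h) hμ.le (hq j).le)
    · exact inv_anti₀ (mul_pos hc hμ) (mul_le_mul (hcq i) (hμq j h) hμ.le (hq i).le)
  have hwalk : ∀ a b (p : (edgesMeeting G U).Walk a b),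
      potential G q s u a - potential G q s u b ≤ p.length * (c * μ)⁻¹ := by
    intro a b p
    induction p with
    | nil => simp
    | cons h p ih =>
      rw [SimpleGraph.Walk.length_cons]
      push_cast
      linarith [hedge _ _ h]
  obtain ⟨p⟩ := hsu
  have h1 := hwalk s u p.toPath.1
  rw [(potential_spec hG hq s u).1, sub_zero] at h1
  refine h1.trans ?_
  rw [div_eq_mul_inv]
  have : p.toPath.1.length ≤ Fintype.card V := p.toPath.2.length_lt.le
  gcongr

end Variation

section Measurability

variable {V : Type*} [Fintype V]

lemma measurable_potential (G : SimpleGraph V) (s u i : V) :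
    Measurable fun q : V → ℝ => potential G q s u i := by
  have hc : Continuous fun q : V → ℝ => groundedLaplacian G q u := by
    unfold groundedLaplacian conductance
    refine Continuous.sub (Continuous.matrix_diagonal ?_) ?_
    · refine continuous_pi fun i => Continuous.add (continuous_finsetSum _ fun j _ => ?_) continuous_const
      split_ifs <;> fun_prop
    · refine continuous_pi fun i => continuous_pi fun j => ?_
      simp only [Matrix.of_apply]
      split_ifs <;> fun_prop
  have : (fun q : V → ℝ => potential G q s u i) = fun q =>
      ((groundedLaplacian G q u).det)⁻¹ *
        ((groundedLaplacian G q u).adjugate.mulVec (Pi.single s 1 - Pi.single u 1)) i := by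
    funext q
    rw [potential, Matrix.inv_def, Matrix.smul_mulVec, Pi.smul_apply, smul_eq_mul,
      Ring.inverse_eq_inv']
  rw [this]
  refine (hc.matrix_det.measurable.inv).mul ?_
  exact ((continuous_apply i).comp (hc.matrix_adjugate.matrix_mulVec continuous_const)).measurable

lemma measurable_inflow (G : SimpleGraph V) (s u i : V) :
    Measurable fun q : V → ℝ => inflow G q s u i := by
  unfold inflow
  refine (measurable_pi_apply i).mul (Finset.measurable_sum _ fun j _ => ?_)
  split_ifs
  · exact measurable_const.max ((measurable_potential G s u j).sub (measurable_potential G s u i))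
  · exact measurable_const

end Measurability

/-! ### Conditional densities -/

section ConditionalDensity

variable {Ω α : Type*} {m mΩ : MeasurableSpace Ω} [MeasurableSpace α]

lemma measure_inter_le_eq_lintegral (hm : m ≤ mΩ) (P : Measure Ω) [IsProbabilityMeasure P]
    {S : Ω → ℝ≥0∞} (hS : Measurable S) {E : Set Ω} (hE : MeasurableSet E) {r R : Ω → ℝ}
    (hr0 : ∀ ω, 0 ≤ r ω)
    (hcond : ∀ s : ℝ≥0, P[({ω | S ω ≤ s ∧ ω ∈ E}.indicator 1 : Ω → ℝ) | m] =ᵐ[P] fun ω =>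
      ∫ u in (0 : ℝ)..s, r ω * Real.exp (-R ω * u))
    {F : Set Ω} (hF : MeasurableSet[m] F) (s : ℝ≥0) :
    P (F ∩ {ω | S ω ≤ s ∧ ω ∈ E}) =
      ∫⁻ ω in F, (∫⁻ t in Ioc (0 : ℝ) s, ENNReal.ofReal (r ω * Real.exp (-R ω * t))) ∂P := by
  have hA : MeasurableSet {ω | S ω ≤ s ∧ ω ∈ E} := (measurableSet_le hS measurable_const).inter hE
  have hint : Integrable ({ω | S ω ≤ s ∧ ω ∈ E}.indicator 1 : Ω → ℝ) P :=
    (integrable_const (1 : ℝ)).indicator hA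
  have h1 : ∫ ω in F, (∫ u in (0 : ℝ)..s, r ω * Real.exp (-R ω * u)) ∂P =
      P.real (F ∩ {ω | S ω ≤ s ∧ ω ∈ E}) := by
    rw [← integral_congr_ae (ae_restrict_of_ae (hcond s)), setIntegral_condExp hm hint hF,
      integral_indicator_one hA, measureReal_restrict_apply hA, inter_comm]
  have h2 : Integrable (fun ω => ∫ u in (0 : ℝ)..s, r ω * Real.exp (-R ω * u)) P :=
    integrable_condExp.congr (hcond s)
  have h3 : ∀ ω, ENNReal.ofReal (∫ u in (0 : ℝ)..s, r ω * Real.exp (-R ω * u)) =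
      ∫⁻ t in Ioc (0 : ℝ) s, ENNReal.ofReal (r ω * Real.exp (-R ω * t)) := by
    intro ω
    rw [intervalIntegral.integral_of_le (NNReal.coe_nonneg s)]
    refine ofReal_integral_eq_lintegral_ofReal ?_
      (Eventually.of_forall fun t => mul_nonneg (hr0 ω) (Real.exp_pos _).le)
    have : Continuous fun t : ℝ => r ω * Real.exp (-R ω * t) := by fun_prop
    exact (this.integrableOn_Icc (μ := volume) (a := (0 : ℝ)) (b := (s : ℝ))).mono_set Ioc_subset_Icc_self
  rw [← ofReal_measureReal (measure_ne_top _ _), ← h1,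
    ofReal_integral_eq_lintegral_ofReal h2.integrableOn]
  · exact lintegral_congr fun ω => h3 ω
  · refine Eventually.of_forall fun ω => ?_
    exact intervalIntegral.integral_nonneg s.2 fun t _ => mul_nonneg (hr0 ω) (Real.exp_pos _).le

/-- If, conditionally on `m`, the random time `S` is at most `s` and the event `E` occurs with the
probability `∫₀ˢ r e^{-R u} du`, then expectations on `E` of functions of `S` and of
`m`-measurable quantities are computed by integrating against the density `r e^{-R u}`. -/
lemma setLIntegral_eq_of_condExp_eq (hm : m ≤ mΩ) (P : Measure Ω) [IsProbabilityMeasure P]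
    {S : Ω → ℝ≥0∞} (hS : Measurable S) {E : Set Ω} (hE : MeasurableSet E) {r R : Ω → ℝ}
    (hr : Measurable r) (hR : Measurable R) (hr0 : ∀ ω, 0 ≤ r ω)
    (hcond : ∀ s : ℝ≥0, P[({ω | S ω ≤ s ∧ ω ∈ E}.indicator 1 : Ω → ℝ) | m] =ᵐ[P] fun ω =>
      ∫ u in (0 : ℝ)..s, r ω * Real.exp (-R ω * u))
    {F : Set Ω} (hF : MeasurableSet[m] F) {Z : Ω → α} (hZ : Measurable[m] Z)
    {g : α × ℝ → ℝ≥0∞} (hg : Measurable g) :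
    ∫⁻ ω in F ∩ (E ∩ {ω | S ω ≠ ∞}), g (Z ω, (S ω).toReal) ∂P =
      ∫⁻ ω in F, (∫⁻ t in Ioi (0 : ℝ),
        ENNReal.ofReal (r ω * Real.exp (-R ω * t)) * g (Z ω, t)) ∂P := by
  have hZ' : Measurable Z := hZ.mono hm le_rfl
  have hF' : MeasurableSet F := hm _ hF
  have hfin : MeasurableSet {ω | S ω ≠ ∞} := (hS (measurableSet_singleton ∞)).compl
  have hρ : Measurable fun p : Ω × ℝ => ENNReal.ofReal (r p.1 * Real.exp (-R p.1 * p.2)) := by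
    fun_prop
  have hSr : Measurable fun ω => (S ω).toReal := hS.ennreal_toReal
  have hrect : ∀ F₁ : Set Ω, MeasurableSet[m] F₁ → ∀ B : Set ℝ, MeasurableSet B →
      (P.restrict (F₁ ∩ (E ∩ {ω | S ω ≠ ∞}))).map (fun ω => (S ω).toReal) B =
      ((((P.restrict F₁).prod (volume.restrict (Ioi (0 : ℝ)))).withDensity
        fun p => ENNReal.ofReal (r p.1 * Real.exp (-R p.1 * p.2))).map Prod.snd) B := by
    intro F₁ hF₁ B _
    congr 1
    refine Measure.ext_of_Iic _ _ fun a => ?_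
    rw [Measure.map_apply hSr measurableSet_Iic, Measure.map_apply measurable_snd measurableSet_Iic,
      Measure.restrict_apply (hSr measurableSet_Iic),
      withDensity_apply _ (measurable_snd measurableSet_Iic)]
    have e1 : (Prod.snd ⁻¹' Iic a : Set (Ω × ℝ)) = univ ×ˢ Iic a := by ext p; simp
    rw [e1, ← Measure.prod_restrict, Measure.restrict_univ,
      Measure.restrict_restrict measurableSet_Iic, lintegral_prod _ hρ.aemeasurable]
    rcases lt_or_ge a 0 with ha | ha
    · have e2 : Iic a ∩ Ioi (0 : ℝ) = ∅ := by
        ext x; simp only [mem_inter_iff, mem_Iic, mem_Ioi, mem_empty_iff_false]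
        constructor
        · rintro ⟨h1, h2⟩; linarith
        · exact False.elim
      have e3 : (fun ω => (S ω).toReal) ⁻¹' Iic a = ∅ := by
        ext ω; simp only [mem_preimage, mem_Iic, mem_empty_iff_false, iff_false, not_le]
        exact ha.trans_le ENNReal.toReal_nonneg
      rw [e2, e3]
      simp
    · lift a to ℝ≥0 using ha
      have e2 : Iic (a : ℝ) ∩ Ioi (0 : ℝ) = Ioc 0 (a : ℝ) := by
        ext x; simp only [mem_inter_iff, mem_Iic, mem_Ioi, mem_Ioc, and_comm]
      have e3 : (fun ω => (S ω).toReal) ⁻¹' Iic (a : ℝ) ∩ (F₁ ∩ (E ∩ {ω | S ω ≠ ∞})) =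
          F₁ ∩ {ω | S ω ≤ a ∧ ω ∈ E} := by
        ext ω
        simp only [mem_inter_iff, mem_preimage, mem_Iic, mem_ofPred_eq]
        constructor
        · rintro ⟨h1, h2, h3, h4⟩
          refine ⟨h2, ?_, h3⟩
          rw [← ENNReal.ofReal_toReal h4, ← ENNReal.ofReal_coe_nnreal]
          exact ENNReal.ofReal_le_ofReal h1
        · rintro ⟨h1, h2, h3⟩
          have h4 : S ω ≠ ∞ := ne_top_of_le_ne_top ENNReal.coe_ne_top h2
          exact ⟨by simpa using ENNReal.toReal_mono ENNReal.coe_ne_top h2, h1, h3, h4⟩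
      rw [e2, e3]
      exact measure_inter_le_eq_lintegral hm P hS hE hr0 hcond hF₁ a
  have hmeas : (P.restrict (F ∩ (E ∩ {ω | S ω ≠ ∞}))).map (fun ω => (Z ω, (S ω).toReal)) =
      (((P.restrict F).prod (volume.restrict (Ioi (0 : ℝ)))).withDensity
        fun p => ENNReal.ofReal (r p.1 * Real.exp (-R p.1 * p.2))).map
          (fun p : Ω × ℝ => (Z p.1, p.2)) := by
    refine Measure.ext_prod fun {A B} hA hB => ?_
    have hpair : Measurable fun p : Ω × ℝ => (Z p.1, p.2) := by fun_prop
    rw [Measure.map_apply (hZ'.prodMk hSr) (hA.prod hB), Measure.map_apply hpair (hA.prod hB),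
      Measure.restrict_apply ((hZ'.prodMk hSr) (hA.prod hB)),
      withDensity_apply _ (hpair (hA.prod hB))]
    have h := hrect (F ∩ Z ⁻¹' A) (hF.inter (hZ hA)) B hB
    rw [Measure.map_apply hSr hB, Measure.map_apply measurable_snd hB,
      Measure.restrict_apply (hSr hB), withDensity_apply _ (measurable_snd hB)] at h
    have e1 : (fun ω => (Z ω, (S ω).toReal)) ⁻¹' A ×ˢ B ∩ (F ∩ (E ∩ {ω | S ω ≠ ∞})) =
        (fun ω => (S ω).toReal) ⁻¹' B ∩ (F ∩ Z ⁻¹' A ∩ (E ∩ {ω | S ω ≠ ∞})) := by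
      ext ω; simp only [mem_inter_iff, mem_preimage, mem_prod]; tauto
    have e2 : (fun p : Ω × ℝ => (Z p.1, p.2)) ⁻¹' A ×ˢ B = (Z ⁻¹' A) ×ˢ B := by
      ext p; simp
    have e3 : (Prod.snd ⁻¹' B : Set (Ω × ℝ)) = univ ×ˢ B := by ext p; simp
    rw [e1, e2, h, e3, ← Measure.prod_restrict, ← Measure.prod_restrict, Measure.restrict_univ,
      Measure.restrict_restrict (hZ' hA), inter_comm F]
  rw [← lintegral_map (f := g) (g := fun ω => (Z ω, (S ω).toReal)) hg (hZ'.prodMk hSr), hmeas,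
    lintegral_map hg (by fun_prop), lintegral_withDensity_eq_lintegral_mul _ hρ (by fun_prop),
    lintegral_prod _ (by fun_prop)]
  rfl

end ConditionalDensity

/-! ### The law of the jump chain -/

section Exponential

lemma setLIntegral_exp_Ioi {R : ℝ} (hR : 0 < R) (a : ℝ) :
    ∫⁻ t in Ioi a, ENNReal.ofReal (R * Real.exp (-R * t)) = ENNReal.ofReal (Real.exp (-R * a)) := by
  rw [← ofReal_integral_eq_lintegral_ofReal
    ((integrableOn_exp_mul_Ioi (neg_neg_of_pos hR) a).const_mul R)
    (Eventually.of_forall fun t => by positivity), integral_const_mul,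
    integral_exp_mul_Ioi (neg_neg_of_pos hR)]
  congr 1
  field_simp

end Exponential

section JumpChain

variable {V : Type*} [Fintype V] {Ω : Type*}

/-- The local times at the time of the `n`-th jump, as random variables. -/
def chainLocalTime (ℓ : V → ℝ) (Y : ℕ → Ω → V) (T : ℕ → Ω → ℝ≥0∞) (n : ℕ) (ω : Ω) : V → ℝ :=
  jumpLocalTime ℓ (fun k => Y k ω) (fun k => T k ω) n

/-- The positions `Y n` and the holding times `T n` follow the law of a vertex-reinforced jump
process. -/
structure HasJumpLaw [MeasurableSpace Ω] [MeasurableSpace V] (G : SimpleGraph V) (ℓ : V → ℝ)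
    (w : ℝ → ℝ) (P : Measure Ω) (Y : ℕ → Ω → V) (T : ℕ → Ω → ℝ≥0∞) : Prop where
  measurable_position : ∀ n, Measurable (Y n)
  measurable_holding : ∀ n, Measurable (T n)
  condExp_eq : ∀ (n : ℕ) (j : V) (s : ℝ≥0),
    P[({ω | T n ω ≤ s ∧ Y (n + 1) ω = j}.indicator 1 : Ω → ℝ) | past Y T n] =ᵐ[P] fun ω =>
      ∫ u in (0 : ℝ)..s, jumpRate G w (chainLocalTime ℓ Y T n ω) (Y n ω) j *
        Real.exp (-exitRate G w (chainLocalTime ℓ Y T n ω) (Y n ω) * u)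

omit [Fintype V] in
lemma chainLocalTime_zero (ℓ : V → ℝ) (Y : ℕ → Ω → V) (T : ℕ → Ω → ℝ≥0∞) (ω : Ω) :
    chainLocalTime ℓ Y T 0 ω = ℓ := by
  funext v
  simp [chainLocalTime, jumpLocalTime]

omit [Fintype V] in
lemma chainLocalTime_succ (ℓ : V → ℝ) (Y : ℕ → Ω → V) (T : ℕ → Ω → ℝ≥0∞) (n : ℕ) (ω : Ω) :
    chainLocalTime ℓ Y T (n + 1) ω = Function.update (chainLocalTime ℓ Y T n ω) (Y n ω)
      (chainLocalTime ℓ Y T n ω (Y n ω) + (T n ω).toReal) := by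
  funext v
  by_cases hv : v = Y n ω
  · subst hv
    simp [chainLocalTime, jumpLocalTime, Finset.sum_range_succ, add_assoc]
  · simp [chainLocalTime, jumpLocalTime, Finset.sum_range_succ, hv, Ne.symm hv]

omit [Fintype V] in
lemma chainLocalTime_succ_self (ℓ : V → ℝ) (Y : ℕ → Ω → V) (T : ℕ → Ω → ℝ≥0∞) (n : ℕ) (ω : Ω) :
    chainLocalTime ℓ Y T (n + 1) ω (Y n ω) =
      chainLocalTime ℓ Y T n ω (Y n ω) + (T n ω).toReal := by
  rw [chainLocalTime_succ, Function.update_self]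

omit [Fintype V] in
lemma chainLocalTime_succ_of_ne (ℓ : V → ℝ) {Y : ℕ → Ω → V} (T : ℕ → Ω → ℝ≥0∞) {n : ℕ} {ω : Ω} {v : V} (hv : v ≠ Y n ω) :
    chainLocalTime ℓ Y T (n + 1) ω v = chainLocalTime ℓ Y T n ω v := by
  rw [chainLocalTime_succ, Function.update_of_ne hv]

omit [Fintype V] in
lemma chainLocalTime_mono (ℓ : V → ℝ) (Y : ℕ → Ω → V) (T : ℕ → Ω → ℝ≥0∞) (ω : Ω) (v : V) :
    Monotone fun n => chainLocalTime ℓ Y T n ω v := by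
  refine monotone_nat_of_le_succ fun n => ?_
  rw [chainLocalTime_succ]
  by_cases hv : v = Y n ω
  · subst hv
    simp
  · simp [hv]

omit [Fintype V] in
lemma le_chainLocalTime (ℓ : V → ℝ) (Y : ℕ → Ω → V) (T : ℕ → Ω → ℝ≥0∞) (n : ℕ) (ω : Ω) (v : V) :
    ℓ v ≤ chainLocalTime ℓ Y T n ω v := by
  have := chainLocalTime_mono ℓ Y T ω v (Nat.zero_le n)
  simpa only [chainLocalTime_zero] using this

variable [MeasurableSpace V]

omit [Fintype V] in
lemma past_mono (Y : ℕ → Ω → V) (T : ℕ → Ω → ℝ≥0∞) : Monotone (past Y T) := by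
  intro n k hnk
  refine sup_le_sup ?_ ?_
  · exact biSup_mono fun i hi => Finset.mem_range.2 (by have := Finset.mem_range.1 hi; omega)
  · exact biSup_mono fun i hi => Finset.mem_range.2 (by have := Finset.mem_range.1 hi; omega)

omit [Fintype V] in
lemma measurable_position_past (Y : ℕ → Ω → V) (T : ℕ → Ω → ℝ≥0∞) {k n : ℕ} (h : k ≤ n) :
    Measurable[past Y T n] (Y k) := by
  rw [measurable_iff_comap_le]
  exact le_sup_of_le_left (le_biSup (fun k => MeasurableSpace.comap (Y k) inferInstance)
    (Finset.mem_range.2 (Nat.lt_succ_of_le h)))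

omit [Fintype V] in
lemma measurable_holding_past (Y : ℕ → Ω → V) (T : ℕ → Ω → ℝ≥0∞) {k n : ℕ} (h : k < n) :
    Measurable[past Y T n] (T k) := by
  rw [measurable_iff_comap_le]
  exact le_sup_of_le_right (le_biSup (fun k => MeasurableSpace.comap (T k) inferInstance)
    (Finset.mem_range.2 h))

variable [MeasurableSingletonClass V]

omit [Fintype V] in
lemma measurable_chainLocalTime_past (ℓ : V → ℝ) (Y : ℕ → Ω → V) (T : ℕ → Ω → ℝ≥0∞) (n : ℕ) :
    Measurable[past Y T n] (chainLocalTime ℓ Y T n) := by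
  let _ := past Y T n
  refine measurable_pi_lambda _ fun v => ?_
  unfold chainLocalTime jumpLocalTime
  refine measurable_const.add (Finset.measurable_sum _ fun k hk => ?_)
  have hk := Finset.mem_range.1 hk
  refine Measurable.ite ?_ (measurable_holding_past Y T hk).ennreal_toReal measurable_const
  exact measurable_position_past Y T hk.le (measurableSet_singleton v)

variable [MeasurableSpace Ω] {G : SimpleGraph V} {ℓ : V → ℝ} {w : ℝ → ℝ} {P : Measure Ω}
  {Y : ℕ → Ω → V} {T : ℕ → Ω → ℝ≥0∞}

omit [MeasurableSingletonClass V] in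
lemma HasJumpLaw.past_le (h : HasJumpLaw G ℓ w P Y T) (n : ℕ) :
    past Y T n ≤ (inferInstance : MeasurableSpace Ω) :=
  sup_le (iSup₂_le fun k _ => (h.measurable_position k).comap_le)
    (iSup₂_le fun k _ => (h.measurable_holding k).comap_le)

omit [Fintype V] [MeasurableSpace V] [MeasurableSingletonClass V] in
lemma jumpRate_nonneg (hpos : ∀ t, 0 < w t) (z : V → ℝ) (i j : V) : 0 ≤ jumpRate G w z i j := by
  unfold jumpRate
  split_ifs
  · exact (hpos _).le
  · exact le_rfl

omit [MeasurableSpace V] [MeasurableSingletonClass V] in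
lemma exitRate_pos [Nontrivial V] (hG : G.Connected) (hpos : ∀ t, 0 < w t) (z : V → ℝ) (i : V) :
    0 < exitRate G w z i := by
  obtain ⟨j, hj⟩ := hG.preconnected.exists_adj_of_nontrivial i
  refine Finset.sum_pos' (fun j _ => jumpRate_nonneg hpos z i j) ⟨j, Finset.mem_univ j, ?_⟩
  rw [jumpRate, if_pos hj]
  exact hpos _

lemma measurable_jumpRate (hw : Monotone w) (j : V) :
    Measurable fun p : (V → ℝ) × V => jumpRate G w p.1 p.2 j := by
  refine measurable_from_prod_countable_left fun i => ?_
  unfold jumpRate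
  by_cases hij : G.Adj i j
  · simp only [hij, if_true]
    exact hw.measurable.comp (measurable_pi_apply j)
  · simp only [hij, if_false]
    exact measurable_const

lemma measurable_exitRate (hw : Monotone w) :
    Measurable fun p : (V → ℝ) × V => exitRate G w p.1 p.2 :=
  Finset.measurable_sum _ fun j _ => measurable_jumpRate hw j

variable [IsProbabilityMeasure P] (h : HasJumpLaw G ℓ w P Y T) (hw : Monotone w)
  (hpos : ∀ t, 0 < w t)
include h hw hpos

lemma HasJumpLaw.setLIntegral_ne_top (n : ℕ) {F : Set Ω} (hF : MeasurableSet[past Y T n] F)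
    {α : Type*} [MeasurableSpace α] {Z : Ω → α} (hZ : Measurable[past Y T n] Z)
    {g : V → α × ℝ → ℝ≥0∞} (hg : ∀ j, Measurable (g j)) :
    ∫⁻ ω in F ∩ {ω | T n ω ≠ ∞}, g (Y (n + 1) ω) (Z ω, (T n ω).toReal) ∂P =
      ∫⁻ ω in F, (∑ j, ∫⁻ t in Ioi (0 : ℝ),
        ENNReal.ofReal (jumpRate G w (chainLocalTime ℓ Y T n ω) (Y n ω) j *
          Real.exp (-exitRate G w (chainLocalTime ℓ Y T n ω) (Y n ω) * t)) * g j (Z ω, t)) ∂P := by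
  have hle := h.past_le n
  have hstate : Measurable[past Y T n] fun ω => (chainLocalTime ℓ Y T n ω, Y n ω) :=
    (measurable_chainLocalTime_past ℓ Y T n).prodMk (measurable_position_past Y T le_rfl)
  have hstate' : Measurable fun ω => (chainLocalTime ℓ Y T n ω, Y n ω) := hstate.mono hle le_rfl
  have hr : ∀ j, Measurable fun ω => jumpRate G w (chainLocalTime ℓ Y T n ω) (Y n ω) j :=
    fun j => (measurable_jumpRate hw j).comp hstate'
  have hR : Measurable fun ω => exitRate G w (chainLocalTime ℓ Y T n ω) (Y n ω) :=
    (measurable_exitRate hw).comp hstate'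
  have hZ' : Measurable Z := hZ.mono hle le_rfl
  have hE : ∀ j, MeasurableSet {ω | Y (n + 1) ω = j} := fun j =>
    h.measurable_position (n + 1) (measurableSet_singleton j)
  have hfin : MeasurableSet {ω | T n ω ≠ ∞} :=
    (h.measurable_holding n (measurableSet_singleton ∞)).compl
  have hsplit : F ∩ {ω | T n ω ≠ ∞} =
      ⋃ j ∈ (Finset.univ : Finset V), F ∩ ({ω | Y (n + 1) ω = j} ∩ {ω | T n ω ≠ ∞}) := by
    ext ω; simp
  rw [hsplit, lintegral_biUnion_finset, lintegral_finsetSum]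
  · refine Finset.sum_congr rfl fun j _ => ?_
    rw [← setLIntegral_eq_of_condExp_eq hle P (h.measurable_holding n) (hE j) (hr j) hR
      (fun ω => jumpRate_nonneg hpos _ _ _) (h.condExp_eq n j) hF hZ (hg j)]
    refine setLIntegral_congr_fun ((hle _ hF).inter ((hE j).inter hfin)) fun ω hω => ?_
    have : Y (n + 1) ω = j := hω.2.1
    simp only [this]
  · intro j _
    have hr := hr j
    have hg := hg j
    have : Measurable fun p : Ω × ℝ =>
        ENNReal.ofReal (jumpRate G w (chainLocalTime ℓ Y T n p.1) (Y n p.1) j *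
          Real.exp (-exitRate G w (chainLocalTime ℓ Y T n p.1) (Y n p.1) * p.2)) *
            g j (Z p.1, p.2) := by
      refine Measurable.mul ?_ (hg.comp ((hZ'.comp measurable_fst).prodMk measurable_snd))
      refine ENNReal.measurable_ofReal.comp ?_
      refine (hr.comp measurable_fst).mul (Real.measurable_exp.comp ?_)
      exact (hR.comp measurable_fst).neg.mul measurable_snd
    exact this.lintegral_prod_right'
  · intro i _ j _ hij
    refine Set.disjoint_left.2 fun ω h1 h2 => hij ?_
    exact (h1.2.1 : Y (n + 1) ω = i).symm.trans h2.2.1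
  · exact fun j _ => (hle _ hF).inter ((hE j).inter hfin)

variable [Nontrivial V] (hG : G.Connected)
include hG

lemma HasJumpLaw.ae_holding_ne_top (n : ℕ) : ∀ᵐ ω ∂P, T n ω ≠ ∞ := by
  have h1 := h.setLIntegral_ne_top hw hpos n (F := univ) MeasurableSet.univ
    (Z := fun _ => ()) measurable_const (g := fun _ _ => 1) (fun _ => measurable_const)
  have h2 : ∀ ω, ∑ j, ∫⁻ t in Ioi (0 : ℝ),
      ENNReal.ofReal (jumpRate G w (chainLocalTime ℓ Y T n ω) (Y n ω) j *
        Real.exp (-exitRate G w (chainLocalTime ℓ Y T n ω) (Y n ω) * t)) * 1 = 1 := by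
    intro ω
    rw [← lintegral_finsetSum _ fun j _ => by fun_prop]
    simp only [mul_one]
    have h3 : ∀ t : ℝ, ∑ j, ENNReal.ofReal (jumpRate G w (chainLocalTime ℓ Y T n ω) (Y n ω) j *
        Real.exp (-exitRate G w (chainLocalTime ℓ Y T n ω) (Y n ω) * t)) =
        ENNReal.ofReal (exitRate G w (chainLocalTime ℓ Y T n ω) (Y n ω) *
        Real.exp (-exitRate G w (chainLocalTime ℓ Y T n ω) (Y n ω) * t)) := by
      intro t
      rw [← ENNReal.ofReal_sum_of_nonneg fun j _ => mul_nonneg (jumpRate_nonneg hpos _ _ _)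
        (Real.exp_pos _).le, ← Finset.sum_mul]
      rfl
    simp only [h3]
    rw [setLIntegral_exp_Ioi (exitRate_pos hG hpos _ _)]
    simp
  simp only [h2, univ_inter, lintegral_one, Measure.restrict_apply_univ, Measure.restrict_univ,
    measure_univ] at h1
  exact (prob_compl_eq_zero_iff ((h.measurable_holding n (measurableSet_singleton ∞)).compl)).2 h1

/-- The joint law of the past up to the `n`-th jump, the next holding time and the next position:
a jump to `j` after the time `t` has the density `r j * exp (- r * t)`. -/
lemma HasJumpLaw.setLIntegral_step (n : ℕ) {F : Set Ω} (hF : MeasurableSet[past Y T n] F)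
    {α : Type*} [MeasurableSpace α] {Z : Ω → α} (hZ : Measurable[past Y T n] Z)
    {g : V → α × ℝ → ℝ≥0∞} (hg : ∀ j, Measurable (g j)) :
    ∫⁻ ω in F, g (Y (n + 1) ω) (Z ω, (T n ω).toReal) ∂P =
      ∫⁻ ω in F, (∑ j, ∫⁻ t in Ioi (0 : ℝ),
        ENNReal.ofReal (jumpRate G w (chainLocalTime ℓ Y T n ω) (Y n ω) j *
          Real.exp (-exitRate G w (chainLocalTime ℓ Y T n ω) (Y n ω) * t)) * g j (Z ω, t)) ∂P := by
  rw [← h.setLIntegral_ne_top hw hpos n hF hZ hg]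
  refine setLIntegral_congr ?_
  filter_upwards [h.ae_holding_ne_top hw hpos hG n] with ω hω
  exact propext ⟨fun h => ⟨h, hω⟩, fun h => h.1⟩

lemma HasJumpLaw.ae_adj (n : ℕ) : ∀ᵐ ω ∂P, G.Adj (Y n ω) (Y (n + 1) ω) := by
  have h1 := h.setLIntegral_step hw hpos hG n (F := univ) MeasurableSet.univ
    (Z := Y n) (measurable_position_past Y T le_rfl)
    (g := fun j p => if G.Adj p.1 j then 0 else 1)
    (fun j => (Measurable.of_discrete (f := fun i => if G.Adj i j then (0 : ℝ≥0∞) else 1)).comp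
      measurable_fst)
  have h2 : ∀ ω, ∑ j, ∫⁻ t in Ioi (0 : ℝ),
      ENNReal.ofReal (jumpRate G w (chainLocalTime ℓ Y T n ω) (Y n ω) j *
        Real.exp (-exitRate G w (chainLocalTime ℓ Y T n ω) (Y n ω) * t)) *
        (if G.Adj (Y n ω) j then 0 else 1) = 0 := by
    intro ω
    refine Finset.sum_eq_zero fun j _ => ?_
    by_cases hj : G.Adj (Y n ω) j <;> simp [hj, jumpRate]
  simp only [h2, lintegral_zero, Measure.restrict_univ] at h1
  rw [lintegral_eq_zero_iff] at h1
  · filter_upwards [h1] with ω hω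
    by_contra hn
    simp [hn] at hω
  · exact (Measurable.of_discrete (f := fun p : V × V => if G.Adj p.1 p.2 then (0 : ℝ≥0∞) else 1)).comp
      ((h.measurable_position n).prodMk (h.measurable_position (n + 1)))

end JumpChain

/-! ### The potential along one step of the walk -/

section Reinforcement

/-- The measure on the line with density `1 / w`. The measure of `(a, b]` is the increment from `a`
to `b` of a primitive of `1 / w`. -/
def invMeasure (w : ℝ → ℝ) : Measure ℝ := volume.withDensity fun t => ENNReal.ofReal (w t)⁻¹

instance (w : ℝ → ℝ) : SFinite (invMeasure w) := by
  unfold invMeasure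
  infer_instance

variable {w : ℝ → ℝ}

lemma invMeasure_Ioc_add (a t : ℝ) :
    invMeasure w (Ioc a (a + t)) =
      ∫⁻ r in Ioi 0, (if r ≤ t then 1 else 0) * ENNReal.ofReal (w (a + r))⁻¹ := by
  rw [invMeasure, withDensity_apply _ measurableSet_Ioc, ← lintegral_indicator measurableSet_Ioc,
    ← lintegral_indicator measurableSet_Ioi, ← lintegral_add_left_eq_self _ a]
  refine lintegral_congr fun r => ?_
  by_cases h1 : 0 < r <;> by_cases h2 : r ≤ t <;> simp [indicator, h1, h2]

/-- The mean increment of the primitive of `1 / w` during an exponential time of rate `R`. -/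
lemma setLIntegral_exp_mul_invMeasure (hw : Monotone w) (a : ℝ) {R : ℝ} (hR : 0 < R) :
    ∫⁻ t in Ioi 0, ENNReal.ofReal (R * Real.exp (-R * t)) * invMeasure w (Ioc a (a + t)) =
      ∫⁻ t in Ioi 0, ENNReal.ofReal (Real.exp (-R * t)) * ENNReal.ofReal (w (a + t))⁻¹ := by
  have hwm := hw.measurable
  simp only [invMeasure_Ioc_add]
  have hmeas : Measurable fun p : ℝ × ℝ => ENNReal.ofReal (R * Real.exp (-R * p.1)) *
      ((if p.2 ≤ p.1 then 1 else 0) * ENNReal.ofReal (w (a + p.2))⁻¹) := by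
    refine Measurable.mul (by fun_prop) (Measurable.mul ?_ (by fun_prop))
    exact Measurable.ite (measurableSet_le measurable_snd measurable_fst) measurable_const
      measurable_const
  have h1 : ∀ t : ℝ, ENNReal.ofReal (R * Real.exp (-R * t)) *
      (∫⁻ r in Ioi 0, (if r ≤ t then 1 else 0) * ENNReal.ofReal (w (a + r))⁻¹) =
      ∫⁻ r in Ioi 0, ENNReal.ofReal (R * Real.exp (-R * t)) *
        ((if r ≤ t then 1 else 0) * ENNReal.ofReal (w (a + r))⁻¹) := by
    intro t
    rw [lintegral_const_mul' _ _ ENNReal.ofReal_ne_top]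
  simp only [h1]
  rw [lintegral_lintegral_swap hmeas.aemeasurable]
  refine setLIntegral_congr_fun measurableSet_Ioi fun r hr => ?_
  have hr : 0 < r := hr
  have h2 : ∀ t : ℝ, ENNReal.ofReal (R * Real.exp (-R * t)) *
      ((if r ≤ t then 1 else 0) * ENNReal.ofReal (w (a + r))⁻¹) =
      (Ici r).indicator (fun t => ENNReal.ofReal (R * Real.exp (-R * t))) t *
        ENNReal.ofReal (w (a + r))⁻¹ := by
    intro t
    by_cases h : r ≤ t <;> simp [indicator, h]
  simp only [h2]
  rw [lintegral_mul_const' _ _ ENNReal.ofReal_ne_top, lintegral_indicator measurableSet_Ici,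
    Measure.restrict_restrict measurableSet_Ici, inter_eq_self_of_subset_left
      (Ici_subset_Ioi.2 hr), setLIntegral_congr Ioi_ae_eq_Ici.symm,
    setLIntegral_exp_Ioi hR]

lemma measurable_invMeasure_Ioc {α : Type*} [MeasurableSpace α] {f g : α → ℝ} (hf : Measurable f)
    (hg : Measurable g) : Measurable fun x => invMeasure w (Ioc (f x) (g x)) := by
  have hs : MeasurableSet {p : α × ℝ | f p.1 < p.2 ∧ p.2 ≤ g p.1} :=
    (measurableSet_lt (hf.comp measurable_fst) measurable_snd).inter
      (measurableSet_le measurable_snd (hg.comp measurable_fst))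
  have h := measurable_measure_prodMk_left (ν := invMeasure w) hs
  have e : ∀ x, Prod.mk x ⁻¹' {p : α × ℝ | f p.1 < p.2 ∧ p.2 ≤ g p.1} = Ioc (f x) (g x) := by
    intro x
    ext y
    simp
  simpa only [e] using h

end Reinforcement

section OneStep

variable {V : Type*} [Fintype V] {G : SimpleGraph V} {w : ℝ → ℝ} [Nontrivial V]
  (hG : G.Connected) (hw : Monotone w) (hpos : ∀ t, 0 < w t)

include hG hw hpos in
lemma sum_setLIntegral_exp (z : V → ℝ) (i : V) (a : ℝ) (c : Prop) {A : V → ℝ → ℝ}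
    (hA : ∀ j, Measurable (A j)) (hA0 : ∀ j, ∀ t ∈ Ioi (0 : ℝ), 0 ≤ A j t) :
    ∑ j, ∫⁻ t in Ioi (0 : ℝ),
      ENNReal.ofReal (jumpRate G w z i j * Real.exp (-exitRate G w z i * t)) *
        (ENNReal.ofReal (A j t) + if c then invMeasure w (Ioc a (a + t)) else 0) =
    ∫⁻ t in Ioi (0 : ℝ), ENNReal.ofReal (Real.exp (-exitRate G w z i * t) *
      (∑ j, jumpRate G w z i j * A j t + if c then (w (a + t))⁻¹ else 0)) := by
  have hwm := hw.measurable
  have hR := exitRate_pos hG hpos z i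
  have hr := fun j => jumpRate_nonneg (G := G) hpos z i j
  have hν : Measurable fun t => invMeasure w (Ioc a (a + t)) :=
    measurable_invMeasure_Ioc measurable_const (by fun_prop)
  have hite : Measurable fun t => if c then invMeasure w (Ioc a (a + t)) else 0 := by
    split_ifs
    · exact hν
    · exact measurable_const
  have hmean : (∫⁻ t in Ioi (0 : ℝ), ENNReal.ofReal (exitRate G w z i *
        Real.exp (-exitRate G w z i * t)) * if c then invMeasure w (Ioc a (a + t)) else 0) =
      ∫⁻ t in Ioi (0 : ℝ), ENNReal.ofReal (Real.exp (-exitRate G w z i * t) *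
        if c then (w (a + t))⁻¹ else 0) := by
    split_ifs
    · rw [setLIntegral_exp_mul_invMeasure hw a hR]
      exact lintegral_congr fun t => (ENNReal.ofReal_mul (Real.exp_pos _).le).symm
    · simp
  have hsum : ∀ t ∈ Ioi (0 : ℝ), ∑ j,
      ENNReal.ofReal (jumpRate G w z i j * Real.exp (-exitRate G w z i * t)) *
        (ENNReal.ofReal (A j t) + if c then invMeasure w (Ioc a (a + t)) else 0) =
      ENNReal.ofReal (Real.exp (-exitRate G w z i * t) * ∑ j, jumpRate G w z i j * A j t) +
        ENNReal.ofReal (exitRate G w z i * Real.exp (-exitRate G w z i * t)) *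
          if c then invMeasure w (Ioc a (a + t)) else 0 := by
    intro t ht
    simp only [mul_add]
    rw [Finset.sum_add_distrib, ← Finset.sum_mul, ← ENNReal.ofReal_sum_of_nonneg
      (fun j _ => mul_nonneg (hr j) (Real.exp_pos _).le), ← Finset.sum_mul]
    congr 1
    rw [Finset.mul_sum, ENNReal.ofReal_sum_of_nonneg fun j _ => mul_nonneg (Real.exp_pos _).le
      (mul_nonneg (hr j) (hA0 j t ht))]
    refine Finset.sum_congr rfl fun j _ => ?_
    rw [← ENNReal.ofReal_mul (mul_nonneg (hr j) (Real.exp_pos _).le)]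
    congr 1
    ring
  rw [← lintegral_finsetSum _ fun j _ => by
    have := hA j
    fun_prop, setLIntegral_congr_fun measurableSet_Ioi hsum,
    lintegral_add_left (by fun_prop), hmean, ← lintegral_add_left (by fun_prop)]
  refine setLIntegral_congr_fun measurableSet_Ioi fun t ht => ?_
  have h0 : 0 ≤ if c then (w (a + t))⁻¹ else 0 := by
    split_ifs
    · exact (inv_pos.2 (hpos _)).le
    · exact le_rfl
  rw [← ENNReal.ofReal_add (mul_nonneg (Real.exp_pos _).le (Finset.sum_nonneg fun j _ =>
    mul_nonneg (hr j) (hA0 j t ht))) (mul_nonneg (Real.exp_pos _).le h0), ← mul_add]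

omit [Nontrivial V] in
include hG hpos in
/-- The generator of the walk with frozen local times `z'`, applied to the potential. -/
lemma sum_jumpRate_mul_potential (z z' : V → ℝ) (s u i : V) (hz : ∀ j, j ≠ i → z' j = z j) :
    ∑ j, jumpRate G w z i j * potential G (w ∘ z') s u j =
      exitRate G w z i * potential G (w ∘ z') s u i +
        ((if i = u then (w (z' i))⁻¹ else 0) - if i = s then (w (z' i))⁻¹ else 0) := by
  have h := (potential_spec hG (q := w ∘ z') (fun v => hpos _) s u).2 i
  have hrate : ∀ j, conductance G (w ∘ z') i j = w (z' i) * jumpRate G w z i j := by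
    intro j
    unfold conductance jumpRate
    split_ifs with hij
    · rw [Function.comp_apply, Function.comp_apply, hz j (G.ne_of_adj hij).symm]
    · simp
  have h2 : netCurrent G (w ∘ z') (potential G (w ∘ z') s u) i = w (z' i) *
      (exitRate G w z i * potential G (w ∘ z') s u i -
        ∑ j, jumpRate G w z i j * potential G (w ∘ z') s u j) := by
    rw [netCurrent, exitRate, Finset.sum_mul, ← Finset.sum_sub_distrib, Finset.mul_sum]
    refine Finset.sum_congr rfl fun j _ => ?_
    rw [hrate]
    ring
  rw [h2] at h
  have hne := (hpos (z' i)).ne'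
  have h3 : exitRate G w z i * potential G (w ∘ z') s u i -
        ∑ j, jumpRate G w z i j * potential G (w ∘ z') s u j =
      (w (z' i))⁻¹ * ((if i = s then 1 else 0) - if i = u then 1 else 0) := by
    rw [← h, inv_mul_cancel_left₀ hne]
  simp only [mul_sub, mul_ite, mul_one, mul_zero] at h3
  linarith

include hG hw hpos in
/-- During one step of the walk from `i`, the potential at the position plus the increment for `s`
of the primitive of `1 / w` grows in mean at most by the increment for `u`, up to the error caused
by the growth of the weight of `i`. -/
lemma step_potential_le (z : V → ℝ) (s u i : V) :
    ∑ j, ∫⁻ t in Ioi (0 : ℝ),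
      ENNReal.ofReal (jumpRate G w z i j * Real.exp (-exitRate G w z i * t)) *
        (ENNReal.ofReal (potential G (w ∘ Function.update z i (z i + t)) s u j) +
          if i = s then invMeasure w (Ioc (z i) (z i + t)) else 0) ≤
    ∑ j, ∫⁻ t in Ioi (0 : ℝ),
      ENNReal.ofReal (jumpRate G w z i j * Real.exp (-exitRate G w z i * t)) *
        (ENNReal.ofReal (potential G (w ∘ z) s u i +
          ((w (z i))⁻¹ - (w (z i + t))⁻¹) * inflow G (w ∘ z) s u i) +
          if i = u then invMeasure w (Ioc (z i) (z i + t)) else 0) := by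
  have hwm := hw.measurable
  have herr : ∀ t ∈ Ioi (0 : ℝ), 0 ≤ ((w (z i))⁻¹ - (w (z i + t))⁻¹) * inflow G (w ∘ z) s u i := by
    intro t ht
    refine mul_nonneg (sub_nonneg.2 (inv_anti₀ (hpos _) (hw ?_))) (inflow_nonneg (fun v => hpos _) s u i)
    have : (0 : ℝ) < t := ht
    linarith
  have hφ0 : ∀ z j, 0 ≤ potential G (w ∘ z) s u j := fun z j =>
    potential_nonneg hG (fun v => hpos _) s u j
  rw [sum_setLIntegral_exp hG hw hpos z i (z i) (i = s)
      (A := fun j t => potential G (w ∘ Function.update z i (z i + t)) s u j) ?_ fun j t _ => hφ0 _ _,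
    sum_setLIntegral_exp hG hw hpos z i (z i) (i = u)
      (A := fun _ t => potential G (w ∘ z) s u i +
          ((w (z i))⁻¹ - (w (z i + t))⁻¹) * inflow G (w ∘ z) s u i)
      (fun _ => by fun_prop) fun _ t ht => add_nonneg (hφ0 _ _) (herr t ht)]
  · refine setLIntegral_mono' measurableSet_Ioi fun t ht => ?_
    refine ENNReal.ofReal_le_ofReal (mul_le_mul_of_nonneg_left ?_ (Real.exp_pos _).le)
    rw [sum_jumpRate_mul_potential hG hpos z _ s u i fun j hj => Function.update_of_ne hj _ _,
      ← Finset.sum_mul, Function.update_self]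
    have hupd : w ∘ Function.update z i (z i + t) = Function.update (w ∘ z) i (w (z i + t)) := by
      rw [Function.comp_update]
    have ht' : (0 : ℝ) < t := ht
    have h1 := potential_update_le hG (q := w ∘ z) (fun v => hpos _) s u i (a := w (z i + t))
      (hw (by linarith))
    rw [← hupd] at h1
    have h2 := mul_le_mul_of_nonneg_left h1 (exitRate_pos hG hpos z i).le
    simp only [Function.comp_apply] at h2
    change _ ≤ exitRate G w z i * _ + _
    linarith
  · intro j
    refine (measurable_potential G s u j).comp (measurable_pi_lambda _ fun v => ?_)
    exact hwm.comp ((measurable_pi_apply v).comp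
      ((measurable_update z).comp (measurable_const.add measurable_id)))

end OneStep

section ChainStep

variable {V : Type*} [Fintype V] [Nontrivial V] [MeasurableSpace V] [MeasurableSingletonClass V]
  {Ω : Type*} [MeasurableSpace Ω] {G : SimpleGraph V} {ℓ : V → ℝ} {w : ℝ → ℝ} {P : Measure Ω}
  {Y : ℕ → Ω → V} {T : ℕ → Ω → ℝ≥0∞} [IsProbabilityMeasure P]

/-- The error made in the `n`-th step by treating the potential as constant in time. -/
def stepError (G : SimpleGraph V) (ℓ : V → ℝ) (w : ℝ → ℝ) (Y : ℕ → Ω → V) (T : ℕ → Ω → ℝ≥0∞)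
    (s u : V) (n : ℕ) (ω : Ω) : ℝ :=
  ((w (chainLocalTime ℓ Y T n ω (Y n ω)))⁻¹ - (w (chainLocalTime ℓ Y T (n + 1) ω (Y n ω)))⁻¹) *
    inflow G (w ∘ chainLocalTime ℓ Y T n ω) s u (Y n ω)

omit [Fintype V] [Nontrivial V] [MeasurableSpace V] [MeasurableSingletonClass V]
  [MeasurableSpace Ω] in
lemma invMeasure_Ioc_succ (n : ℕ) (ω : Ω) (v : V) :
    invMeasure w (Ioc (chainLocalTime ℓ Y T n ω v) (chainLocalTime ℓ Y T (n + 1) ω v)) =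
      if Y n ω = v then invMeasure w (Ioc (chainLocalTime ℓ Y T n ω (Y n ω))
        (chainLocalTime ℓ Y T n ω (Y n ω) + (T n ω).toReal)) else 0 := by
  split_ifs with hv
  · subst hv
    rw [chainLocalTime_succ_self]
  · rw [chainLocalTime_succ_of_ne ℓ T (Ne.symm hv), Ioc_self, measure_empty]

omit [Nontrivial V] in
lemma measurable_of_forall_middle {α β γ : Type*} [MeasurableSpace α] [MeasurableSpace β]
    [MeasurableSpace γ] {f : (α × V) × β → γ} (hf : ∀ i, Measurable fun p : α × β => f ((p.1, i), p.2)) :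
    Measurable f := by
  have h : Measurable fun p : (α × β) × V => f ((p.1.1, p.2), p.1.2) :=
    measurable_from_prod_countable_left hf
  exact h.comp (f := fun p : (α × V) × β => ((p.1.1, p.2), p.1.2)) (by fun_prop)

variable (h : HasJumpLaw G ℓ w P Y T) (hG : G.Connected) (hw : Monotone w) (hpos : ∀ t, 0 < w t)
include h hG hw hpos

lemma HasJumpLaw.setLIntegral_potential_le (s u : V) (n : ℕ) {F : Set Ω}
    (hF : MeasurableSet[past Y T n] F) :
    ∫⁻ ω in F, (ENNReal.ofReal (potential G (w ∘ chainLocalTime ℓ Y T (n + 1) ω) s u (Y (n + 1) ω)) +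
      invMeasure w (Ioc (chainLocalTime ℓ Y T n ω s) (chainLocalTime ℓ Y T (n + 1) ω s))) ∂P ≤
    ∫⁻ ω in F, (ENNReal.ofReal (potential G (w ∘ chainLocalTime ℓ Y T n ω) s u (Y n ω) +
        stepError G ℓ w Y T s u n ω) +
      invMeasure w (Ioc (chainLocalTime ℓ Y T n ω u) (chainLocalTime ℓ Y T (n + 1) ω u))) ∂P := by
  have hwm := hw.measurable
  have hstate : Measurable[past Y T n] fun ω => (chainLocalTime ℓ Y T n ω, Y n ω) :=
    (measurable_chainLocalTime_past ℓ Y T n).prodMk (measurable_position_past Y T le_rfl)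
  have hinv : ∀ (v i : V), Measurable fun p : (V → ℝ) × ℝ =>
      if i = v then invMeasure w (Ioc (p.1 i) (p.1 i + p.2)) else 0 := by
    intro v i
    split_ifs
    · exact measurable_invMeasure_Ioc (by fun_prop) (by fun_prop)
    · exact measurable_const
  have e1 := h.setLIntegral_step hw hpos hG n hF hstate
    (g := fun j p => ENNReal.ofReal (potential G
        (w ∘ Function.update p.1.1 p.1.2 (p.1.1 p.1.2 + p.2)) s u j) +
      if p.1.2 = s then invMeasure w (Ioc (p.1.1 p.1.2) (p.1.1 p.1.2 + p.2)) else 0) (by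
    intro j
    refine measurable_of_forall_middle fun i => ?_
    refine Measurable.add (ENNReal.measurable_ofReal.comp ?_) (hinv s i)
    refine (measurable_potential G s u j).comp (measurable_pi_lambda _ fun v => hwm.comp ?_)
    by_cases hv : v = i
    · subst hv
      simp only [Function.update_self]
      fun_prop
    · simp only [Function.update_of_ne hv]
      fun_prop)
  have e2 := h.setLIntegral_step hw hpos hG n hF hstate
    (g := fun _ p => ENNReal.ofReal (potential G (w ∘ p.1.1) s u p.1.2 +
        ((w (p.1.1 p.1.2))⁻¹ - (w (p.1.1 p.1.2 + p.2))⁻¹) * inflow G (w ∘ p.1.1) s u p.1.2) +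
      if p.1.2 = u then invMeasure w (Ioc (p.1.1 p.1.2) (p.1.1 p.1.2 + p.2)) else 0) (by
    intro j
    refine measurable_of_forall_middle fun i => ?_
    refine Measurable.add (ENNReal.measurable_ofReal.comp ?_) (hinv u i)
    have hwp : Measurable fun p : (V → ℝ) × ℝ => w ∘ p.1 :=
      measurable_pi_lambda _ fun v => hwm.comp (by fun_prop)
    have hdiff : Measurable fun p : (V → ℝ) × ℝ => (w (p.1 i))⁻¹ - (w (p.1 i + p.2))⁻¹ := by
      fun_prop
    refine ((measurable_potential G s u i).comp hwp).add (hdiff.mul ?_)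
    exact (measurable_inflow G s u i).comp hwp)
  calc _ = _ := lintegral_congr fun ω => by
        rw [invMeasure_Ioc_succ, chainLocalTime_succ]
    _ = _ := e1
    _ ≤ _ := lintegral_mono fun ω => step_potential_le hG hw hpos (chainLocalTime ℓ Y T n ω) s u (Y n ω)
    _ = _ := e2.symm
    _ = _ := lintegral_congr fun ω => by
        rw [invMeasure_Ioc_succ, stepError, chainLocalTime_succ_self]

end ChainStep

/-! ### Comparison of the growth of local times -/

section Telescoping

variable {V : Type*} {Ω : Type*} {ℓ : V → ℝ} {w : ℝ → ℝ}
  {Y : ℕ → Ω → V} {T : ℕ → Ω → ℝ≥0∞}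

/-- The event that at the time of the `n`-th jump all local times outside `U` are at most `M`. -/
def boundedEvent (ℓ : V → ℝ) (Y : ℕ → Ω → V) (T : ℕ → Ω → ℝ≥0∞) (U : Set V) (M : ℝ) (n : ℕ) :
    Set Ω :=
  {ω | ∀ b, b ∉ U → chainLocalTime ℓ Y T n ω b ≤ M}

/-- The event that the local times on `U` are unbounded and those outside `U` are at most `M`
forever. -/
def localizationEvent (ℓ : V → ℝ) (Y : ℕ → Ω → V) (T : ℕ → Ω → ℝ≥0∞) (U : Set V) (M : ℝ) : Set Ω :=
  {ω | (∀ n, ω ∈ boundedEvent ℓ Y T U M n) ∧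
    ∀ v ∈ U, ∀ K : ℕ, ∃ n, (K : ℝ) ≤ chainLocalTime ℓ Y T n ω v}

lemma boundedEvent_antitone (U : Set V) (M : ℝ) : Antitone (boundedEvent ℓ Y T U M) :=
  fun _ _ hnk ω hω b hb => (chainLocalTime_mono ℓ Y T ω b hnk).trans (hω b hb)

lemma localizationEvent_tendsto {U : Set V} {M : ℝ} {ω : Ω}
    (hω : ω ∈ localizationEvent ℓ Y T U M) {v : V} (hv : v ∈ U) :
    Tendsto (fun n => chainLocalTime ℓ Y T n ω v) atTop atTop := by
  refine tendsto_atTop_atTop_of_monotone (chainLocalTime_mono ℓ Y T ω v) fun b => ?_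
  obtain ⟨K, hK⟩ := exists_nat_ge b
  obtain ⟨n, hn⟩ := hω.2 v hv K
  exact ⟨n, hK.trans hn⟩

lemma sum_invMeasure_Ioc (n N : ℕ) (ω : Ω) (v : V) :
    ∑ k ∈ Finset.range N, invMeasure w
        (Ioc (chainLocalTime ℓ Y T (n + k) ω v) (chainLocalTime ℓ Y T (n + k + 1) ω v)) =
      invMeasure w (Ioc (chainLocalTime ℓ Y T n ω v) (chainLocalTime ℓ Y T (n + N) ω v)) := by
  induction N with
  | zero => simp
  | succ N ih =>
    have hm := chainLocalTime_mono ℓ Y T ω v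
    rw [Finset.sum_range_succ, ih, ← measure_union _ measurableSet_Ioc,
      Ioc_union_Ioc_eq_Ioc (hm (Nat.le_add_right n N)) (hm (Nat.le_succ _))]
    · rfl
    · exact Ioc_disjoint_Ioc_of_le le_rfl

lemma iSup_invMeasure_Ioc {a : ℝ} {f : ℕ → ℝ} (hf : Monotone f) (hlim : Tendsto f atTop atTop) :
    ⨆ n, invMeasure w (Ioc a (f n)) = invMeasure w (Ioi a) := by
  rw [← Monotone.measure_iUnion fun n k hnk => Ioc_subset_Ioc_right (hf hnk)]
  congr 1
  ext x
  simp only [mem_iUnion, mem_Ioc, mem_Ioi, exists_and_left, and_iff_left_iff_imp]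
  exact fun _ => (hlim.eventually_ge_atTop x).exists

variable [Fintype V] [MeasurableSpace V] [MeasurableSingletonClass V]

lemma measurableSet_boundedEvent (U : Set V) (M : ℝ) (n : ℕ) :
    MeasurableSet[past Y T n] (boundedEvent ℓ Y T U M n) := by
  have h := measurable_chainLocalTime_past ℓ Y T n
  have : boundedEvent ℓ Y T U M n =
      chainLocalTime ℓ Y T n ⁻¹' (⋂ b ∈ Uᶜ, (fun z : V → ℝ => z b) ⁻¹' Iic M) := by
    ext ω
    simp [boundedEvent]
  rw [this]
  exact h (MeasurableSet.biInter (to_countable _) fun b _ => measurable_pi_apply b measurableSet_Iic)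

lemma measurableSet_localizationEvent (U : Set V) (M : ℝ) :
    MeasurableSet[⨆ n, past Y T n] (localizationEvent ℓ Y T U M) := by
  have : localizationEvent ℓ Y T U M = (⋂ n, boundedEvent ℓ Y T U M n) ∩
      ⋂ v ∈ U, ⋂ K : ℕ, ⋃ n, chainLocalTime ℓ Y T n ⁻¹' ((fun z : V → ℝ => z v) ⁻¹' Ici (K : ℝ)) := by
    ext ω
    simp [localizationEvent]
  rw [this]
  have hle : ∀ n, past Y T n ≤ ⨆ n, past Y T n := fun n => le_iSup (past Y T) n
  refine MeasurableSet.inter (MeasurableSet.iInter fun n => hle n _ (measurableSet_boundedEvent U M n)) ?_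
  refine MeasurableSet.biInter (to_countable _) fun v _ => MeasurableSet.iInter fun K =>
    MeasurableSet.iUnion fun n => hle n _ ?_
  exact measurable_chainLocalTime_past ℓ Y T n (measurable_pi_apply v measurableSet_Ici)

end Telescoping

section Comparison

variable {V : Type*} [Fintype V] [Nontrivial V] [MeasurableSpace V] [MeasurableSingletonClass V]
  {Ω : Type*} [MeasurableSpace Ω] {G : SimpleGraph V} {ℓ : V → ℝ} {w : ℝ → ℝ} {P : Measure Ω}
  {Y : ℕ → Ω → V} {T : ℕ → Ω → ℝ≥0∞} [IsProbabilityMeasure P]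

/-- The constant in the comparison of the local times of two vertices; here `c` is a lower bound for
`w` and `m` is the value of `w` at the bound for the local times outside `U`. -/
def comparisonConst (V : Type*) [Fintype V] (c m : ℝ) : ℝ :=
  Fintype.card V / c + Fintype.card V * (Fintype.card V / c + m * Fintype.card V ^ 2 / c ^ 2)

omit [Nontrivial V] [IsProbabilityMeasure P] in
lemma measurable_chainLocalTime (h : HasJumpLaw G ℓ w P Y T) (n : ℕ) :
    Measurable (chainLocalTime ℓ Y T n) :=
  (measurable_chainLocalTime_past ℓ Y T n).mono (h.past_le n) le_rfl

omit [Nontrivial V] [IsProbabilityMeasure P] in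
lemma measurable_invMeasure_chainLocalTime (h : HasJumpLaw G ℓ w P Y T) (n k : ℕ) (v : V) :
    Measurable fun ω => invMeasure w
      (Ioc (chainLocalTime ℓ Y T n ω v) (chainLocalTime ℓ Y T k ω v)) :=
  measurable_invMeasure_Ioc ((measurable_pi_apply v).comp (measurable_chainLocalTime h n))
    ((measurable_pi_apply v).comp (measurable_chainLocalTime h k))

variable (hG : G.Connected) (hw : Monotone w) {c : ℝ} (hc : 0 < c) (hcw : ∀ t, c ≤ w t)
include hG hw hc hcw

omit [Nontrivial V] [MeasurableSpace V] [MeasurableSingletonClass V] [MeasurableSpace Ω] in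
/-- Along a path whose local times outside `U` stay bounded, the sum of all errors is of the order
of `1 / w` at the smallest local time in `U`. -/
lemma sum_stepError_le {U : Set V} {M : ℝ} {s u : V}
    (hsu : (edgesMeeting G U).Reachable s u) {n : ℕ} {ω : Ω}
    (hmin : ∀ v ∈ U, chainLocalTime ℓ Y T n ω s ≤ chainLocalTime ℓ Y T n ω v) (N : ℕ) :
    ENNReal.ofReal (potential G (w ∘ chainLocalTime ℓ Y T n ω) s u (Y n ω)) +
      ∑ k ∈ Finset.range N, (boundedEvent ℓ Y T U M (n + k)).indicator
        (fun ω => ENNReal.ofReal (stepError G ℓ w Y T s u (n + k) ω)) ω ≤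
    ENNReal.ofReal (comparisonConst V c (w M) / w (chainLocalTime ℓ Y T n ω s)) := by
  have hpos : ∀ t, 0 < w t := fun t => hc.trans_le (hcw t)
  set L := fun k => chainLocalTime ℓ Y T (n + k) ω with hL
  have hLmono : ∀ v, Monotone fun k => L k v := fun v i j hij =>
    chainLocalTime_mono ℓ Y T ω v (Nat.add_le_add_left hij n)
  set μ := w (chainLocalTime ℓ Y T n ω s) with hμ
  have hμpos : 0 < μ := hpos _
  have hμle : ∀ k, ∀ v ∈ U, μ ≤ w (L k v) := fun k v hv =>
    hw ((hmin v hv).trans (hLmono v (Nat.zero_le k)))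
  set d : ℝ := (Fintype.card V : ℝ) with hd
  have hd0 : 0 ≤ d := Nat.cast_nonneg _
  have hφ : ∀ k, potential G (w ∘ L k) s u s ≤ d / (c * μ) := fun k =>
    potential_le_card_div hG (q := w ∘ L k) (fun v => hpos _) hsu hc (fun v => hcw _) hμpos (hμle k)
  set K : V → ℝ := fun v => if v ∈ U then d / c else w M * (d * (d / (c * μ))) with hK
  have hK0 : ∀ v, 0 ≤ K v := by
    intro v
    have := hpos M
    simp only [hK]
    split_ifs <;> positivity
  have hinv : ∀ k v, 0 ≤ (w (L k v))⁻¹ - (w (L (k + 1) v))⁻¹ := fun k v =>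
    sub_nonneg.2 (inv_anti₀ (hpos _) (hw (hLmono v (Nat.le_succ k))))
  have hstep : ∀ k, (boundedEvent ℓ Y T U M (n + k)).indicator
      (fun ω => ENNReal.ofReal (stepError G ℓ w Y T s u (n + k) ω)) ω ≤
      ENNReal.ofReal (∑ v, K v * ((w (L k v))⁻¹ - (w (L (k + 1) v))⁻¹)) := by
    intro k
    by_cases hB : ω ∈ boundedEvent ℓ Y T U M (n + k)
    · rw [indicator_of_mem hB]
      refine ENNReal.ofReal_le_ofReal ?_
      set i := Y (n + k) ω with hi
      have h1 : stepError G ℓ w Y T s u (n + k) ω =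
          ((w (L k i))⁻¹ - (w (L (k + 1) i))⁻¹) * inflow G (w ∘ L k) s u i := rfl
      have h2 : inflow G (w ∘ L k) s u i ≤ K i := by
        simp only [hK]
        split_ifs with hiU
        · exact inflow_le_card_div hG (fun v => hpos _) s u i hc fun v => hcw _
        · refine (inflow_le_mul hG (fun v => hpos _) s u i).trans ?_
          refine mul_le_mul (hw (hB i hiU)) (mul_le_mul_of_nonneg_left (hφ k) hd0)
            (mul_nonneg hd0 (potential_nonneg hG (fun v => hpos _) s u s)) (hpos _).le
      rw [h1, mul_comm]
      refine (mul_le_mul_of_nonneg_right h2 (hinv k i)).trans ?_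
      exact Finset.single_le_sum (f := fun v => K v * ((w (L k v))⁻¹ - (w (L (k + 1) v))⁻¹))
        (fun v _ => mul_nonneg (hK0 v) (hinv k v)) (Finset.mem_univ i)
    · rw [indicator_of_notMem hB]
      exact zero_le
  have hsum : ∑ k ∈ Finset.range N, ∑ v, K v * ((w (L k v))⁻¹ - (w (L (k + 1) v))⁻¹) ≤
      d * (d / c + w M * d ^ 2 / c ^ 2) / μ := by
    rw [Finset.sum_comm]
    have hv : ∀ v, ∑ k ∈ Finset.range N, K v * ((w (L k v))⁻¹ - (w (L (k + 1) v))⁻¹) ≤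
        (d / c + w M * d ^ 2 / c ^ 2) / μ := by
      intro v
      rw [← Finset.mul_sum, Finset.sum_range_sub' (fun k => (w (L k v))⁻¹) N]
      have h1 : (w (L 0 v))⁻¹ - (w (L N v))⁻¹ ≤ (w (L 0 v))⁻¹ := sub_le_self _ (inv_pos.2 (hpos _)).le
      refine (mul_le_mul_of_nonneg_left h1 (hK0 v)).trans ?_
      have hM := hpos M
      simp only [hK]
      split_ifs with hvU
      · have h2 : (w (L 0 v))⁻¹ ≤ μ⁻¹ := inv_anti₀ hμpos (hμle 0 v hvU)
        calc d / c * (w (L 0 v))⁻¹ ≤ d / c * μ⁻¹ := by gcongr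
          _ = d / c / μ := by rw [div_eq_mul_inv (d / c)]
          _ ≤ _ := by
            gcongr
            exact le_add_of_nonneg_right (by positivity)
      · have h2 : (w (L 0 v))⁻¹ ≤ c⁻¹ := inv_anti₀ hc (hcw _)
        calc w M * (d * (d / (c * μ))) * (w (L 0 v))⁻¹ ≤ w M * (d * (d / (c * μ))) * c⁻¹ := by gcongr
          _ = w M * d ^ 2 / c ^ 2 / μ := by field_simp
          _ ≤ _ := by
            gcongr
            exact le_add_of_nonneg_left (by positivity)
    refine (Finset.sum_le_sum fun v _ => hv v).trans ?_
    rw [Finset.sum_const, nsmul_eq_mul, Finset.card_univ]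
    exact (mul_div_assoc _ _ _).ge
  have h0 : potential G (w ∘ L 0) s u (Y n ω) ≤ d / c / μ := by
    refine (potential_le hG (fun v => hpos _) s u _).trans ((hφ 0).trans (le_of_eq ?_))
    rw [div_div]
  have hsum0 : 0 ≤ ∑ k ∈ Finset.range N, ∑ v, K v * ((w (L k v))⁻¹ - (w (L (k + 1) v))⁻¹) :=
    Finset.sum_nonneg fun k _ => Finset.sum_nonneg fun v _ => mul_nonneg (hK0 v) (hinv k v)
  calc _ ≤ ENNReal.ofReal (potential G (w ∘ L 0) s u (Y n ω)) + ∑ k ∈ Finset.range N,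
        ENNReal.ofReal (∑ v, K v * ((w (L k v))⁻¹ - (w (L (k + 1) v))⁻¹)) :=
        add_le_add le_rfl (Finset.sum_le_sum fun k _ => hstep k)
    _ = ENNReal.ofReal (potential G (w ∘ L 0) s u (Y n ω) +
        ∑ k ∈ Finset.range N, ∑ v, K v * ((w (L k v))⁻¹ - (w (L (k + 1) v))⁻¹)) := by
        rw [ENNReal.ofReal_add (potential_nonneg hG (q := w ∘ L 0) (fun v => hpos _) s u _) hsum0,
          ENNReal.ofReal_sum_of_nonneg fun k _ => Finset.sum_nonneg fun v _ =>
            mul_nonneg (hK0 v) (hinv k v)]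
    _ ≤ _ := by
        refine ENNReal.ofReal_le_ofReal ?_
        rw [comparisonConst, add_div]
        exact add_le_add h0 hsum

variable (h : HasJumpLaw G ℓ w P Y T)
include h

omit [Nontrivial V] [IsProbabilityMeasure P] hG hc hcw in
lemma HasJumpLaw.measurable_potential_position (s u : V) (n : ℕ) : Measurable fun ω =>
    potential G (w ∘ chainLocalTime ℓ Y T n ω) s u (Y n ω) := by
  have hwp : Measurable fun z : V → ℝ => w ∘ z :=
    measurable_pi_lambda _ fun v => hw.measurable.comp (measurable_pi_apply v)
  have hm1 : ∀ i, Measurable fun z : V → ℝ => potential G (w ∘ z) s u i := fun i =>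
    (measurable_potential G s u i).comp hwp
  have hm : Measurable fun p : (V → ℝ) × V => potential G (w ∘ p.1) s u p.2 :=
    measurable_from_prod_countable_left hm1
  have hst : Measurable fun ω => (chainLocalTime ℓ Y T n ω, Y n ω) :=
    (measurable_chainLocalTime h n).prodMk (h.measurable_position n)
  simpa only [Function.comp_def] using hm.comp hst

omit [Nontrivial V] [IsProbabilityMeasure P] hG hc hcw in
lemma HasJumpLaw.measurable_stepError (s u : V) (n : ℕ) :
    Measurable (stepError G ℓ w Y T s u n) := by
  have hwm := hw.measurable
  have hm : Measurable fun p : ((V → ℝ) × V) × ℝ => ((w (p.1.1 p.1.2))⁻¹ -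
      (w (p.1.1 p.1.2 + p.2))⁻¹) * inflow G (w ∘ p.1.1) s u p.1.2 := by
    refine measurable_of_forall_middle fun i => ?_
    have hwp : Measurable fun p : (V → ℝ) × ℝ => w ∘ p.1 :=
      measurable_pi_lambda _ fun v => hwm.comp (by fun_prop)
    have hdiff : Measurable fun p : (V → ℝ) × ℝ => (w (p.1 i))⁻¹ - (w (p.1 i + p.2))⁻¹ := by
      fun_prop
    exact hdiff.mul ((measurable_inflow G s u i).comp hwp)
  have e : stepError G ℓ w Y T s u n = fun ω =>
      ((w (chainLocalTime ℓ Y T n ω (Y n ω)))⁻¹ -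
        (w (chainLocalTime ℓ Y T n ω (Y n ω) + (T n ω).toReal))⁻¹) *
      inflow G (w ∘ chainLocalTime ℓ Y T n ω) s u (Y n ω) := by
    funext ω
    rw [stepError, chainLocalTime_succ_self]
  rw [e]
  exact hm.comp (((measurable_chainLocalTime h n).prodMk (h.measurable_position n)).prodMk
    (h.measurable_holding n).ennreal_toReal)

lemma HasJumpLaw.telescope_potential_le (U : Set V) (M : ℝ) (s u : V) (n : ℕ) {F : Set Ω}
    (hF : MeasurableSet[past Y T n] F) (N : ℕ) :
    ∑ k ∈ Finset.range N, ∫⁻ ω in F ∩ boundedEvent ℓ Y T U M (n + k), invMeasure w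
        (Ioc (chainLocalTime ℓ Y T (n + k) ω s) (chainLocalTime ℓ Y T (n + k + 1) ω s)) ∂P +
      ∫⁻ ω in F ∩ boundedEvent ℓ Y T U M (n + N),
        ENNReal.ofReal (potential G (w ∘ chainLocalTime ℓ Y T (n + N) ω) s u (Y (n + N) ω)) ∂P ≤
    ∫⁻ ω in F, ENNReal.ofReal (potential G (w ∘ chainLocalTime ℓ Y T n ω) s u (Y n ω)) ∂P +
      ∑ k ∈ Finset.range N, ∫⁻ ω in F ∩ boundedEvent ℓ Y T U M (n + k),
        (ENNReal.ofReal (stepError G ℓ w Y T s u (n + k) ω) + invMeasure w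
        (Ioc (chainLocalTime ℓ Y T (n + k) ω u) (chainLocalTime ℓ Y T (n + k + 1) ω u))) ∂P := by
  have hpos : ∀ t, 0 < w t := fun t => hc.trans_le (hcw t)
  have hmν := fun k v => measurable_invMeasure_chainLocalTime h k (k + 1) v
  have hmφ := fun k => (h.measurable_potential_position hw s u k).ennreal_ofReal
  have hme := fun k => (h.measurable_stepError hw s u k).ennreal_ofReal
  induction N with
  | zero =>
    simp only [Finset.range_zero, Finset.sum_empty, zero_add, add_zero]
    exact lintegral_mono_set inter_subset_left
  | succ N ih =>
    rw [Finset.sum_range_succ, Finset.sum_range_succ]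
    have hFN : MeasurableSet[past Y T (n + N)] (F ∩ boundedEvent ℓ Y T U M (n + N)) :=
      MeasurableSet.inter (past_mono Y T (Nat.le_add_right n N) _ hF) (measurableSet_boundedEvent U M _)
    have h1 := h.setLIntegral_potential_le hG hw hpos s u (n + N) hFN
    rw [lintegral_add_left (hmφ _)] at h1
    have h2 : ∫⁻ ω in F ∩ boundedEvent ℓ Y T U M (n + N + 1), ENNReal.ofReal (potential G
        (w ∘ chainLocalTime ℓ Y T (n + N + 1) ω) s u (Y (n + N + 1) ω)) ∂P ≤
        ∫⁻ ω in F ∩ boundedEvent ℓ Y T U M (n + N), ENNReal.ofReal (potential G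
        (w ∘ chainLocalTime ℓ Y T (n + N + 1) ω) s u (Y (n + N + 1) ω)) ∂P :=
      lintegral_mono_set (inter_subset_inter_right _ (boundedEvent_antitone U M (Nat.le_succ _)))
    have h3 : ∫⁻ ω in F ∩ boundedEvent ℓ Y T U M (n + N),
        (ENNReal.ofReal (potential G (w ∘ chainLocalTime ℓ Y T (n + N) ω) s u (Y (n + N) ω) +
          stepError G ℓ w Y T s u (n + N) ω) + invMeasure w
        (Ioc (chainLocalTime ℓ Y T (n + N) ω u) (chainLocalTime ℓ Y T (n + N + 1) ω u))) ∂P ≤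
        ∫⁻ ω in F ∩ boundedEvent ℓ Y T U M (n + N),
          ENNReal.ofReal (potential G (w ∘ chainLocalTime ℓ Y T (n + N) ω) s u (Y (n + N) ω)) ∂P +
        ∫⁻ ω in F ∩ boundedEvent ℓ Y T U M (n + N),
        (ENNReal.ofReal (stepError G ℓ w Y T s u (n + N) ω) + invMeasure w
        (Ioc (chainLocalTime ℓ Y T (n + N) ω u) (chainLocalTime ℓ Y T (n + N + 1) ω u))) ∂P := by
      rw [← lintegral_add_left (hmφ _)]
      refine lintegral_mono fun ω => ?_
      simp only
      rw [← add_assoc]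
      exact add_le_add ENNReal.ofReal_add_le le_rfl
    have h4 := (add_le_add h2 le_rfl).trans (h1.trans h3)
    calc _ = ∑ k ∈ Finset.range N, (∫⁻ ω in F ∩ boundedEvent ℓ Y T U M (n + k), invMeasure w
        (Ioc (chainLocalTime ℓ Y T (n + k) ω s) (chainLocalTime ℓ Y T (n + k + 1) ω s)) ∂P) + _ := by
          rw [add_assoc, add_comm (∫⁻ ω in F ∩ boundedEvent ℓ Y T U M (n + N), _ ∂P)]
          rfl
      _ ≤ _ := add_le_add le_rfl h4
      _ = _ := (add_assoc _ _ _).symm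
      _ ≤ _ := add_le_add ih le_rfl
      _ = _ := add_assoc _ _ _

/-- If `s` has the smallest local time in `U` at the time of the `n`-th jump, then on the event that
the local times on `U` grow to infinity, the full remaining increment for `s` of the primitive of
`1 / w` is in mean at most that for `u`, up to a smaller error. -/
lemma HasJumpLaw.setLIntegral_invMeasure_Ioi_le {U : Set V} {M : ℝ} {s u : V} (hsU : s ∈ U)
    (hsu : (edgesMeeting G U).Reachable s u) (n : ℕ) {F : Set Ω}
    (hF : MeasurableSet[past Y T n] F)
    (hmin : ∀ ω ∈ F, ∀ v ∈ U, chainLocalTime ℓ Y T n ω s ≤ chainLocalTime ℓ Y T n ω v) :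
    ∫⁻ ω in F ∩ localizationEvent ℓ Y T U M, invMeasure w (Ioi (chainLocalTime ℓ Y T n ω s)) ∂P ≤
      ∫⁻ ω in F, (ENNReal.ofReal (comparisonConst V c (w M) / w (chainLocalTime ℓ Y T n ω s)) +
        invMeasure w (Ioi (chainLocalTime ℓ Y T n ω u))) ∂P := by
  have hmν := measurable_invMeasure_chainLocalTime h
  have hmφ := fun k => (h.measurable_potential_position hw s u k).ennreal_ofReal
  have hme := fun k => (h.measurable_stepError hw s u k).ennreal_ofReal
  have hF' : MeasurableSet F := h.past_le n _ hF
  have hB : ∀ k, MeasurableSet (boundedEvent ℓ Y T U M k) := fun k =>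
    h.past_le k _ (measurableSet_boundedEvent U M k)
  have hA : MeasurableSet (localizationEvent ℓ Y T U M) :=
    (iSup_le fun k => h.past_le k) _ (measurableSet_localizationEvent U M)
  have key : ∀ N, ∫⁻ ω in F ∩ localizationEvent ℓ Y T U M, invMeasure w
      (Ioc (chainLocalTime ℓ Y T n ω s) (chainLocalTime ℓ Y T (n + N) ω s)) ∂P ≤
      ∫⁻ ω in F, (ENNReal.ofReal (comparisonConst V c (w M) / w (chainLocalTime ℓ Y T n ω s)) +
        invMeasure w (Ioi (chainLocalTime ℓ Y T n ω u))) ∂P := by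
    intro N
    calc _ = ∑ k ∈ Finset.range N, ∫⁻ ω in F ∩ localizationEvent ℓ Y T U M, invMeasure w
          (Ioc (chainLocalTime ℓ Y T (n + k) ω s) (chainLocalTime ℓ Y T (n + k + 1) ω s)) ∂P := by
          rw [← lintegral_finsetSum _ fun k _ => hmν _ _ _]
          exact lintegral_congr fun ω => (sum_invMeasure_Ioc n N ω s).symm
      _ ≤ ∑ k ∈ Finset.range N, ∫⁻ ω in F ∩ boundedEvent ℓ Y T U M (n + k), invMeasure w
          (Ioc (chainLocalTime ℓ Y T (n + k) ω s) (chainLocalTime ℓ Y T (n + k + 1) ω s)) ∂P :=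
          Finset.sum_le_sum fun k _ => lintegral_mono_set
            (inter_subset_inter_right _ fun ω hω => hω.1 (n + k))
      _ ≤ _ := le_self_add.trans (h.telescope_potential_le hG hw hc hcw U M s u n hF N)
      _ = ∫⁻ ω in F, (ENNReal.ofReal (potential G (w ∘ chainLocalTime ℓ Y T n ω) s u (Y n ω)) +
          ∑ k ∈ Finset.range N, (boundedEvent ℓ Y T U M (n + k)).indicator (fun ω =>
            (ENNReal.ofReal (stepError G ℓ w Y T s u (n + k) ω) + invMeasure w
            (Ioc (chainLocalTime ℓ Y T (n + k) ω u) (chainLocalTime ℓ Y T (n + k + 1) ω u)))) ω) ∂P := by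
          rw [lintegral_add_left (hmφ _), lintegral_finsetSum]
          · congr 1
            refine Finset.sum_congr rfl fun k _ => ?_
            rw [lintegral_indicator (hB _), Measure.restrict_restrict (hB _), inter_comm]
          · exact fun k _ => ((hme _).add (hmν _ _ _)).indicator (hB _)
      _ ≤ _ := by
          refine setLIntegral_mono' hF' fun ω hω => ?_
          have h1 := sum_stepError_le (M := M) hG hw hc hcw hsu (hmin ω hω) N
          have h2 : ∑ k ∈ Finset.range N, (boundedEvent ℓ Y T U M (n + k)).indicator (fun ω =>
            invMeasure w (Ioc (chainLocalTime ℓ Y T (n + k) ω u)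
              (chainLocalTime ℓ Y T (n + k + 1) ω u))) ω ≤
              invMeasure w (Ioi (chainLocalTime ℓ Y T n ω u)) := by
            refine (Finset.sum_le_sum fun k _ => indicator_le_self _ _ ω).trans ?_
            rw [sum_invMeasure_Ioc]
            exact measure_mono Ioc_subset_Ioi_self
          refine le_trans (le_of_eq ?_) (add_le_add h1 h2)
          rw [add_assoc, ← Finset.sum_add_distrib]
          congr 1
          refine Finset.sum_congr rfl fun k _ => ?_
          exact congrFun (indicator_add _ _ _) ω
  have hsup : ∫⁻ ω in F ∩ localizationEvent ℓ Y T U M,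
      invMeasure w (Ioi (chainLocalTime ℓ Y T n ω s)) ∂P =
      ⨆ N, ∫⁻ ω in F ∩ localizationEvent ℓ Y T U M, invMeasure w
      (Ioc (chainLocalTime ℓ Y T n ω s) (chainLocalTime ℓ Y T (n + N) ω s)) ∂P := by
    rw [← lintegral_iSup (fun N => hmν _ _ _) fun N K hNK ω => measure_mono
      (Ioc_subset_Ioc_right (chainLocalTime_mono ℓ Y T ω s (Nat.add_le_add_left hNK n)))]
    refine setLIntegral_congr_fun (hF'.inter hA) fun ω hω => ?_
    refine (iSup_invMeasure_Ioc (f := fun N => chainLocalTime ℓ Y T (n + N) ω s) (fun N K hNK =>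
      chainLocalTime_mono ℓ Y T ω s (Nat.add_le_add_left hNK n)) ?_).symm
    have := (localizationEvent_tendsto hω.2 hsU).comp (tendsto_add_atTop_nat n)
    refine this.congr fun N => ?_
    simp only [Function.comp_apply, add_comm]
  rw [hsup]
  exact iSup_le key

end Comparison

/-! ### Connectivity of the localization set -/

section Connectivity

variable {V : Type*} [Fintype V] [Nontrivial V] [MeasurableSpace V] [MeasurableSingletonClass V]
  {Ω : Type*} [MeasurableSpace Ω] {G : SimpleGraph V} {ℓ : V → ℝ} {w : ℝ → ℝ} {P : Measure Ω}
  {Y : ℕ → Ω → V} {T : ℕ → Ω → ℝ≥0∞} [IsProbabilityMeasure P]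
  (hG : G.Connected) (hw : Monotone w) (hpos : ∀ t, 0 < w t) (h : HasJumpLaw G ℓ w P Y T)

omit [Nontrivial V] [MeasurableSpace V] [MeasurableSingletonClass V] in
lemma jumpRate_le_exitRate (hpos : ∀ t, 0 < w t) (z : V → ℝ) (i j : V) :
    jumpRate G w z i j ≤ exitRate G w z i :=
  Finset.single_le_sum (fun j _ => jumpRate_nonneg hpos z i j) (Finset.mem_univ j)

omit [Fintype V] [Nontrivial V] [MeasurableSpace V] [MeasurableSingletonClass V] in
lemma jumpRate_le (hw : Monotone w) (hpos : ∀ t, 0 < w t) {z : V → ℝ} {j : V} {M : ℝ}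
    (hj : z j ≤ M) (i : V) : jumpRate G w z i j ≤ w M := by
  unfold jumpRate
  split_ifs
  · exact hw hj
  · exact (hpos M).le

include hG hw hpos h

/-- A jump to a vertex with bounded local time leads back to a neighbour `v` of that vertex, unless
an event of probability of order `1 / w (L v)` occurs. -/
lemma HasJumpLaw.measure_two_jumps_le (U : Set V) (M : ℝ) (n : ℕ) :
    P (({ω | Y (n + 1) ω ∉ U} ∩ boundedEvent ℓ Y T U M (n + 1)) ∩ {ω | Y (n + 2) ω ∉ U}) ≤
      Fintype.card V * ∫⁻ ω in {ω | Y (n + 1) ω ∉ U} ∩ boundedEvent ℓ Y T U M (n + 1),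
        ENNReal.ofReal (w M / w (chainLocalTime ℓ Y T (n + 1) ω (Y n ω))) ∂P := by
  set F := {ω | Y (n + 1) ω ∉ U} ∩ boundedEvent ℓ Y T U M (n + 1) with hFdef
  have hU : MeasurableSet Uᶜ := (toFinite Uᶜ).measurableSet
  have hF : MeasurableSet[past Y T (n + 1)] F :=
    MeasurableSet.inter (measurable_position_past Y T le_rfl hU) (measurableSet_boundedEvent U M _)
  have hF' : MeasurableSet F := h.past_le _ _ hF
  have hE : MeasurableSet {ω | Y (n + 2) ω ∉ U} := h.measurable_position (n + 2) hU
  have h1 := h.setLIntegral_step hw hpos hG (n + 1) hF (Z := fun _ => ()) measurable_const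
    (g := fun j _ => if j ∈ U then 0 else 1) fun j => measurable_const
  have h2 : P (F ∩ {ω | Y (n + 2) ω ∉ U}) = ∫⁻ ω in F, if Y (n + 1 + 1) ω ∈ U then 0 else 1 ∂P := by
    have e : ∀ ω, (if Y (n + 1 + 1) ω ∈ U then (0 : ℝ≥0∞) else 1) =
        {ω | Y (n + 2) ω ∉ U}.indicator 1 ω := by
      intro ω
      by_cases hω : Y (n + 2) ω ∈ U <;> simp [hω]
    simp only [e]
    rw [lintegral_indicator_one hE, Measure.restrict_apply hE, inter_comm]
  rw [h2, h1, ← lintegral_const_mul' _ _ (ENNReal.natCast_ne_top _)]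
  refine lintegral_mono_ae ?_
  filter_upwards [ae_restrict_of_ae (h.ae_adj hw hpos hG n), ae_restrict_mem hF'] with ω hadj hω
  set z := chainLocalTime ℓ Y T (n + 1) ω
  set i := Y (n + 1) ω
  have hR := exitRate_pos hG hpos z i
  have hM := hpos M
  have hRv : w (z (Y n ω)) ≤ exitRate G w z i := by
    have := jumpRate_le_exitRate (G := G) hpos z i (Y n ω)
    rwa [jumpRate, if_pos hadj.symm] at this
  have hj : ∀ j, ∫⁻ t in Ioi (0 : ℝ), ENNReal.ofReal (jumpRate G w z i j *
      Real.exp (-exitRate G w z i * t)) * (if j ∈ U then 0 else 1) ≤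
      ENNReal.ofReal (w M / w (z (Y n ω))) := by
    intro j
    by_cases hjU : j ∈ U
    · simp [hjU]
    · simp only [hjU, if_false, mul_one]
      have hr := jumpRate_le (G := G) hw hpos (hω.2 j hjU) i
      calc _ ≤ ∫⁻ t in Ioi (0 : ℝ), ENNReal.ofReal (w M / w (z (Y n ω))) *
            ENNReal.ofReal (exitRate G w z i * Real.exp (-exitRate G w z i * t)) := by
            refine lintegral_mono fun t => ?_
            rw [← ENNReal.ofReal_mul (div_pos hM (hpos _)).le]
            refine ENNReal.ofReal_le_ofReal ?_
            rw [← mul_assoc]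
            refine mul_le_mul_of_nonneg_right (hr.trans ?_) (Real.exp_pos _).le
            rw [div_mul_eq_mul_div, le_div_iff₀ (hpos _)]
            exact mul_le_mul_of_nonneg_left hRv hM.le
        _ = _ := by
            rw [lintegral_const_mul' _ _ ENNReal.ofReal_ne_top, setLIntegral_exp_Ioi hR]
            simp
  refine (Finset.sum_le_sum fun j _ => hj j).trans ?_
  rw [Finset.sum_const, nsmul_eq_mul, Finset.card_univ]

lemma HasJumpLaw.setLIntegral_inv_le (U : Set V) (M : ℝ) (n : ℕ) :
    ∫⁻ ω in {ω | Y (n + 1) ω ∉ U} ∩ boundedEvent ℓ Y T U M (n + 1),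
        ENNReal.ofReal (w M / w (chainLocalTime ℓ Y T (n + 1) ω (Y n ω))) ∂P ≤
      Fintype.card V * (ENNReal.ofReal (w M) * (ENNReal.ofReal (w M) * ∑ v, ∫⁻ ω, invMeasure w
        (Ioc (chainLocalTime ℓ Y T n ω v) (chainLocalTime ℓ Y T (n + 1) ω v)) ∂P)) := by
  have hwm := hw.measurable
  have hM := hpos M
  have hU : MeasurableSet Uᶜ := (toFinite Uᶜ).measurableSet
  have hF' : MeasurableSet ({ω | Y (n + 1) ω ∉ U} ∩ boundedEvent ℓ Y T U M (n + 1)) :=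
    (h.measurable_position (n + 1) hU).inter (h.past_le _ _ (measurableSet_boundedEvent U M _))
  have hstate : Measurable[past Y T n] fun ω => (chainLocalTime ℓ Y T n ω, Y n ω) :=
    (measurable_chainLocalTime_past ℓ Y T n).prodMk (measurable_position_past Y T le_rfl)
  have h1 := h.setLIntegral_step hw hpos hG n (F := univ) MeasurableSet.univ hstate
    (g := fun j p => if p.1.1 j ≤ M then ENNReal.ofReal (w M / w (p.1.1 p.1.2 + p.2)) else 0) (by
    intro j
    refine measurable_of_forall_middle fun i => ?_
    refine Measurable.ite ?_ ?_ measurable_const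
    · exact measurableSet_le ((measurable_pi_apply j).comp measurable_fst) measurable_const
    · have : Measurable fun p : (V → ℝ) × ℝ => ENNReal.ofReal (w M / w (p.1 i + p.2)) := by fun_prop
      exact this)
  have h2 := h.setLIntegral_step hw hpos hG n (F := univ) MeasurableSet.univ hstate
    (g := fun _ p => invMeasure w (Ioc (p.1.1 p.1.2) (p.1.1 p.1.2 + p.2))) (by
    intro j
    refine measurable_of_forall_middle fun i => ?_
    have : Measurable fun p : (V → ℝ) × ℝ => invMeasure w (Ioc (p.1 i) (p.1 i + p.2)) :=
      measurable_invMeasure_Ioc (by fun_prop) (by fun_prop)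
    exact this)
  rw [Measure.restrict_univ] at h1 h2
  have h3 : ∑ v, ∫⁻ ω, invMeasure w
        (Ioc (chainLocalTime ℓ Y T n ω v) (chainLocalTime ℓ Y T (n + 1) ω v)) ∂P =
      ∫⁻ ω, invMeasure w (Ioc (chainLocalTime ℓ Y T n ω (Y n ω))
        (chainLocalTime ℓ Y T n ω (Y n ω) + (T n ω).toReal)) ∂P := by
    rw [← lintegral_finsetSum _ fun v _ => measurable_invMeasure_chainLocalTime h n (n + 1) v]
    refine lintegral_congr fun ω => ?_
    simp only [invMeasure_Ioc_succ]
    rw [Finset.sum_ite_eq Finset.univ (Y n ω), if_pos (Finset.mem_univ _)]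
  calc _ ≤ ∫⁻ ω, (if chainLocalTime ℓ Y T n ω (Y (n + 1) ω) ≤ M then ENNReal.ofReal
          (w M / w (chainLocalTime ℓ Y T n ω (Y n ω) + (T n ω).toReal)) else 0) ∂P := by
        refine (setLIntegral_mono' hF' fun ω hω => ?_).trans (setLIntegral_le_lintegral _ _)
        rw [if_pos, chainLocalTime_succ_self]
        exact (chainLocalTime_mono ℓ Y T ω _ (Nat.le_succ n)).trans (hω.2 _ hω.1)
    _ = _ := h1
    _ ≤ ∫⁻ ω, Fintype.card V * (ENNReal.ofReal (w M) * (ENNReal.ofReal (w M) *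
          ∑ j, ∫⁻ t in Ioi (0 : ℝ),
          ENNReal.ofReal (jumpRate G w (chainLocalTime ℓ Y T n ω) (Y n ω) j *
            Real.exp (-exitRate G w (chainLocalTime ℓ Y T n ω) (Y n ω) * t)) *
          invMeasure w (Ioc (chainLocalTime ℓ Y T n ω (Y n ω))
            (chainLocalTime ℓ Y T n ω (Y n ω) + t)))) ∂P := by
        refine lintegral_mono fun ω => ?_
        set z := chainLocalTime ℓ Y T n ω
        set i := Y n ω
        have e := sum_setLIntegral_exp hG hw hpos z i (z i) True (A := fun _ _ => 0)
          (fun _ => measurable_const) fun _ _ _ => le_rfl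
        simp only [ENNReal.ofReal_zero, if_true, zero_add, mul_zero, Finset.sum_const_zero] at e
        rw [e, ← Finset.card_univ, ← nsmul_eq_mul, ← Finset.sum_const]
        refine Finset.sum_le_sum fun j _ => ?_
        rw [← lintegral_const_mul' _ _ ENNReal.ofReal_ne_top,
          ← lintegral_const_mul' _ _ ENNReal.ofReal_ne_top]
        refine lintegral_mono fun t => ?_
        simp only
        split_ifs with hj
        · rw [← ENNReal.ofReal_mul (mul_nonneg (jumpRate_nonneg hpos _ _ _) (Real.exp_pos _).le),
            ← ENNReal.ofReal_mul hM.le, ← ENNReal.ofReal_mul hM.le]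
          refine ENNReal.ofReal_le_ofReal ?_
          have hr := jumpRate_le (G := G) hw hpos hj i
          have he := (Real.exp_pos (-exitRate G w z i * t)).le
          have hwt := (inv_pos.2 (hpos (z i + t))).le
          calc _ = jumpRate G w z i j * (w M * (Real.exp (-exitRate G w z i * t) *
                (w (z i + t))⁻¹)) := by rw [div_eq_mul_inv]; ring
            _ ≤ _ := by gcongr
        · simp
    _ = _ := by
        rw [lintegral_const_mul' _ _ (ENNReal.natCast_ne_top _),
          lintegral_const_mul' _ _ ENNReal.ofReal_ne_top,
          lintegral_const_mul' _ _ ENNReal.ofReal_ne_top, ← h2, h3]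

/-- Almost surely, if the local times outside `U` stay bounded, then from some time on the walk never
makes a jump between two vertices outside `U`. -/
lemma HasJumpLaw.ae_eventually_edgesMeeting (hfin : ∀ v, invMeasure w (Ioi (ℓ v)) ≠ ∞)
    (U : Set V) (M : ℝ) : ∀ᵐ ω ∂P, (∀ n, ω ∈ boundedEvent ℓ Y T U M n) →
      ∀ᶠ n in atTop, (edgesMeeting G U).Adj (Y n ω) (Y (n + 1) ω) := by
  have hmν := fun n v => measurable_invMeasure_chainLocalTime h n (n + 1) v
  have hsum : ∀ v, ∑' n, ∫⁻ ω, invMeasure w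
      (Ioc (chainLocalTime ℓ Y T n ω v) (chainLocalTime ℓ Y T (n + 1) ω v)) ∂P ≤
      invMeasure w (Ioi (ℓ v)) := by
    intro v
    refine ENNReal.tsum_le_of_sum_range_le fun N => ?_
    rw [← lintegral_finsetSum _ fun n _ => hmν n v]
    calc _ ≤ ∫⁻ _, invMeasure w (Ioi (ℓ v)) ∂P := by
          refine lintegral_mono fun ω => ?_
          have := sum_invMeasure_Ioc (ℓ := ℓ) (w := w) (Y := Y) (T := T) 0 N ω v
          simp only [zero_add, chainLocalTime_zero] at this
          simp only [this]
          exact measure_mono Ioc_subset_Ioi_self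
      _ = _ := by simp
  have hK : ∀ n, P (({ω | Y (n + 1) ω ∉ U} ∩ boundedEvent ℓ Y T U M (n + 1)) ∩
      {ω | Y (n + 2) ω ∉ U}) ≤ (Fintype.card V * (Fintype.card V * (ENNReal.ofReal (w M) *
        ENNReal.ofReal (w M)))) * ∑ v, ∫⁻ ω, invMeasure w
        (Ioc (chainLocalTime ℓ Y T n ω v) (chainLocalTime ℓ Y T (n + 1) ω v)) ∂P := by
    intro n
    refine (h.measure_two_jumps_le hG hw hpos U M n).trans ?_
    refine (mul_le_mul_right (h.setLIntegral_inv_le hG hw hpos U M n) _).trans (le_of_eq ?_)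
    ring
  have hlim : ∑' n, P (({ω | Y (n + 1) ω ∉ U} ∩ boundedEvent ℓ Y T U M (n + 1)) ∩
      {ω | Y (n + 2) ω ∉ U}) ≠ ∞ := by
    refine ne_top_of_le_ne_top ?_ (ENNReal.tsum_le_tsum hK)
    rw [ENNReal.tsum_mul_left, Summable.tsum_finsetSum fun _ _ => ENNReal.summable]
    refine ENNReal.mul_ne_top ?_ ?_
    · exact ENNReal.mul_ne_top (ENNReal.natCast_ne_top _) (ENNReal.mul_ne_top
        (ENNReal.natCast_ne_top _) (ENNReal.mul_ne_top ENNReal.ofReal_ne_top ENNReal.ofReal_ne_top))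
    · exact ENNReal.sum_ne_top.2 fun v _ => ne_top_of_le_ne_top (hfin v) (hsum v)
  filter_upwards [ae_eventually_notMem hlim, ae_all_iff.2 fun n => h.ae_adj hw hpos hG n]
    with ω hω hadj hB
  obtain ⟨N, hN⟩ := eventually_atTop.1 hω
  refine eventually_atTop.2 ⟨N + 1, fun n hn => ⟨hadj n, ?_⟩⟩
  obtain ⟨k, rfl⟩ : ∃ k, n = k + 1 := ⟨n - 1, by omega⟩
  by_contra! hcon
  exact hN k (by omega) ⟨⟨hcon.1, hB _⟩, hcon.2⟩

omit [Fintype V] [Nontrivial V] [MeasurableSpace V] [MeasurableSingletonClass V]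
  [MeasurableSpace Ω] hG hw hpos h in
lemma frequently_position_eq {U : Set V} {M : ℝ} {ω : Ω}
    (hω : ω ∈ localizationEvent ℓ Y T U M) {v : V} (hv : v ∈ U) : ∃ᶠ n in atTop, Y n ω = v := by
  intro hcon
  obtain ⟨N, hN⟩ := eventually_atTop.1 hcon
  have hconst : ∀ k, chainLocalTime ℓ Y T (N + k) ω v = chainLocalTime ℓ Y T N ω v := by
    intro k
    induction k with
    | zero => rfl
    | succ k ih =>
      rw [← ih]
      exact chainLocalTime_succ_of_ne ℓ T fun e => hN (N + k) (Nat.le_add_right _ _) e.symm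
  obtain ⟨n, hn, hnN⟩ := (((localizationEvent_tendsto hω hv).eventually_gt_atTop
    (chainLocalTime ℓ Y T N ω v)).and (eventually_ge_atTop N)).exists
  obtain ⟨k, rfl⟩ := Nat.exists_eq_add_of_le hnN
  rw [hconst] at hn
  exact lt_irrefl _ hn

/-- Almost surely, if exactly the local times on `U` grow to infinity, then `U` is connected by
edges that meet `U`. -/
lemma HasJumpLaw.ae_reachable (hfin : ∀ v, invMeasure w (Ioi (ℓ v)) ≠ ∞) (U : Set V) (M : ℝ) :
    ∀ᵐ ω ∂P, ω ∈ localizationEvent ℓ Y T U M →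
      ∀ s ∈ U, ∀ u ∈ U, (edgesMeeting G U).Reachable s u := by
  filter_upwards [h.ae_eventually_edgesMeeting hG hw hpos hfin U M] with ω hω hA s hs u hu
  obtain ⟨N, hN⟩ := eventually_atTop.1 (hω hA.1)
  obtain ⟨n, hn, hns⟩ := (frequently_atTop.1 (frequently_position_eq hA hs)) N
  obtain ⟨k, hk, hku⟩ := (frequently_atTop.1 (frequently_position_eq hA hu)) n
  have hreach : ∀ j, (edgesMeeting G U).Reachable (Y n ω) (Y (n + j) ω) := by
    intro j
    induction j with
    | zero => exact SimpleGraph.Reachable.refl _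
    | succ j ih => exact ih.trans (hN (n + j) (by omega)).reachable
  obtain ⟨j, rfl⟩ := Nat.exists_eq_add_of_le hk
  rw [← hns, ← hku]
  exact hreach j

end Connectivity

/-! ### Power laws and the zero-one law -/

section PowerLaw

variable {w : ℝ → ℝ} {κ α a : ℝ}

lemma invMeasure_Ioi_le (hκ : 0 < κ) (hα : 1 < α) (ha : 0 < a)
    (hlow : ∀ t, a ≤ t → κ⁻¹ * t ^ α ≤ w t) {y : ℝ} (hy : a ≤ y) :
    invMeasure w (Ioi y) ≤ ENNReal.ofReal (κ / (α - 1) * y ^ (1 - α)) := by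
  have hy0 : 0 < y := ha.trans_le hy
  have hint := integrableOn_Ioi_rpow_of_lt (a := -α) (by linarith) hy0
  have h1 : ∫ t in Ioi y, κ * t ^ (-α) = κ / (α - 1) * y ^ (1 - α) := by
    rw [integral_const_mul, integral_Ioi_rpow_of_lt (by linarith) hy0,
      show -α + 1 = -(α - 1) by ring, show 1 - α = -(α - 1) by ring]
    have : α - 1 ≠ 0 := by linarith
    field_simp
  rw [invMeasure, withDensity_apply _ measurableSet_Ioi, ← h1,
    ofReal_integral_eq_lintegral_ofReal (hint.const_mul κ)]
  · refine setLIntegral_mono' measurableSet_Ioi fun t ht => ENNReal.ofReal_le_ofReal ?_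
    have ht' : y < t := ht
    have ht0 : 0 < t := hy0.trans ht'
    have h2 := hlow t (hy.trans ht'.le)
    have h3 : 0 < κ⁻¹ * t ^ α := by positivity
    refine (inv_anti₀ h3 h2).trans (le_of_eq ?_)
    rw [mul_inv, inv_inv, Real.rpow_neg ht0.le]
  · filter_upwards [ae_restrict_mem measurableSet_Ioi] with t ht
    have ht0 : 0 < t := hy0.trans ht
    positivity

lemma le_invMeasure_Ioi (hκ : 0 < κ) (ha : 0 < a) (hw : Monotone w) (hpos : ∀ t, 0 < w t)
    (hup : ∀ t, a ≤ t → w t ≤ κ * t ^ α) {x : ℝ} (hx : a ≤ x) :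
    ENNReal.ofReal ((κ * 2 ^ α)⁻¹ * x ^ (1 - α)) ≤ invMeasure w (Ioi x) := by
  have hx0 : 0 < x := ha.trans_le hx
  calc _ ≤ ENNReal.ofReal ((w (2 * x))⁻¹) * ENNReal.ofReal (2 * x - x) := by
        rw [← ENNReal.ofReal_mul (inv_pos.2 (hpos _)).le]
        refine ENNReal.ofReal_le_ofReal ?_
        have h1 := hup (2 * x) (by linarith)
        rw [Real.mul_rpow zero_le_two hx0.le] at h1
        have h2 := inv_anti₀ (hpos _) h1
        rw [show 2 * x - x = x by ring]
        refine le_trans (le_of_eq ?_) (mul_le_mul_of_nonneg_right h2 hx0.le)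
        rw [Real.rpow_sub hx0, Real.rpow_one]
        have := Real.rpow_pos_of_pos hx0 α
        field_simp
    _ = ∫⁻ _ in Ioc x (2 * x), ENNReal.ofReal ((w (2 * x))⁻¹) := by
        rw [setLIntegral_const, Real.volume_Ioc]
    _ ≤ ∫⁻ t in Ioc x (2 * x), ENNReal.ofReal (w t)⁻¹ :=
        setLIntegral_mono' measurableSet_Ioc fun t ht =>
          ENNReal.ofReal_le_ofReal (inv_anti₀ (hpos _) (hw ht.2))
    _ = invMeasure w (Ioc x (2 * x)) := by rw [invMeasure, withDensity_apply _ measurableSet_Ioc]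
    _ ≤ _ := measure_mono Ioc_subset_Ioi_self

/-- For `x` large and much smaller than `y`, the integral of `1 / w` from `x` to infinity is larger
than the integral from `y` and larger than any fixed multiple of `1 / w x`. -/
lemma exists_invMeasure_Ioi_le_half (hκ : 0 < κ) (hα : 1 < α) (ha : 0 < a) (hw : Monotone w)
    (hpos : ∀ t, 0 < w t) (hlow : ∀ t, a ≤ t → κ⁻¹ * t ^ α ≤ w t)
    (hup : ∀ t, a ≤ t → w t ≤ κ * t ^ α) :
    ∃ ε : ℝ, 0 < ε ∧ ε ≤ 1 ∧ ∀ C : ℝ, 0 ≤ C → ∃ K : ℝ, ∀ x y, K ≤ x → x ≤ ε * y →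
      ENNReal.ofReal (C / w x) + invMeasure w (Ioi y) ≤ 2⁻¹ * invMeasure w (Ioi x) := by
  have hα1 : 0 < α - 1 := by linarith
  set b := (κ * 2 ^ α)⁻¹ with hb
  have hb0 : 0 < b := by positivity
  set δ := b / 4 * ((α - 1) / κ) with hδ
  have hδ0 : 0 < δ := by positivity
  refine ⟨min 1 (δ ^ (α - 1)⁻¹), lt_min one_pos (by positivity), min_le_left _ _, fun C hC =>
    ⟨max a (4 * C * κ / b), fun x y hx hxy => ?_⟩⟩
  set ε := min 1 (δ ^ (α - 1)⁻¹) with hε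
  have hε0 : 0 < ε := lt_min one_pos (by positivity)
  have hε1 : ε ≤ 1 := min_le_left _ _
  have hεδ : ε ^ (α - 1) ≤ δ := by
    calc ε ^ (α - 1) ≤ (δ ^ (α - 1)⁻¹) ^ (α - 1) :=
          Real.rpow_le_rpow hε0.le (min_le_right _ _) hα1.le
      _ = δ := Real.rpow_inv_rpow hδ0.le hα1.ne'
  have hxa : a ≤ x := (le_max_left _ _).trans hx
  have hx0 : 0 < x := ha.trans_le hxa
  have hxC : 4 * C * κ / b ≤ x := (le_max_right _ _).trans hx
  have hy0 : 0 < y := by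
    by_contra! hy
    nlinarith
  have hxy' : x ≤ y := hxy.trans (by nlinarith)
  have hxp : 0 < x ^ (1 - α) := Real.rpow_pos_of_pos hx0 _
  have h1 : C / w x ≤ b / 4 * x ^ (1 - α) := by
    have hl := hlow x hxa
    have hxα := Real.rpow_pos_of_pos hx0 α
    have hl0 : 0 < κ⁻¹ * x ^ α := by positivity
    calc C / w x ≤ C / (κ⁻¹ * x ^ α) := div_le_div_of_nonneg_left hC hl0 hl
      _ = (4 * C * κ / b) * (b / 4 * (x ^ α)⁻¹) := by field_simp
      _ ≤ x * (b / 4 * (x ^ α)⁻¹) := by gcongr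
      _ = b / 4 * x ^ (1 - α) := by
        rw [Real.rpow_sub hx0, Real.rpow_one]
        field_simp
  have h2 : κ / (α - 1) * y ^ (1 - α) ≤ b / 4 * x ^ (1 - α) := by
    have hxe : 0 < x / ε := div_pos hx0 hε0
    have hye : x / ε ≤ y := by rwa [div_le_iff₀ hε0, mul_comm]
    have h3 : y ^ (1 - α) ≤ (x / ε) ^ (1 - α) :=
      Real.rpow_le_rpow_of_nonpos hxe hye (by linarith)
    have h4 : (x / ε) ^ (1 - α) = x ^ (1 - α) * ε ^ (α - 1) := by
      rw [Real.div_rpow hx0.le hε0.le, show 1 - α = -(α - 1) by ring, Real.rpow_neg hε0.le,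
        div_inv_eq_mul]
    calc κ / (α - 1) * y ^ (1 - α) ≤ κ / (α - 1) * (x ^ (1 - α) * δ) := by
          rw [h4] at h3
          gcongr
          exact h3.trans (by gcongr)
      _ = b / 4 * x ^ (1 - α) := by
          rw [hδ]
          field_simp
  calc _ ≤ ENNReal.ofReal (b / 4 * x ^ (1 - α)) + ENNReal.ofReal (b / 4 * x ^ (1 - α)) :=
        add_le_add (ENNReal.ofReal_le_ofReal h1) ((invMeasure_Ioi_le hκ hα ha hlow
          (hxa.trans hxy')).trans (ENNReal.ofReal_le_ofReal h2))
    _ = 2⁻¹ * ENNReal.ofReal (b * x ^ (1 - α)) := by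
        rw [← ENNReal.ofReal_add (by positivity) (by positivity), ← ENNReal.ofReal_ofNat 2,
          ← ENNReal.ofReal_inv_of_pos two_pos, ← ENNReal.ofReal_mul (by positivity)]
        congr 1
        ring
    _ ≤ _ := by
        gcongr
        exact le_invMeasure_Ioi hκ ha hw hpos hup hxa

end PowerLaw

section Levy

variable {V : Type*} [Fintype V] [Nontrivial V] [MeasurableSpace V] [MeasurableSingletonClass V]
  {Ω : Type*} [MeasurableSpace Ω] {G : SimpleGraph V} {ℓ : V → ℝ} {w : ℝ → ℝ} {P : Measure Ω}
  {Y : ℕ → Ω → V} {T : ℕ → Ω → ℝ≥0∞} [IsProbabilityMeasure P]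
  (hG : G.Connected) (hw : Monotone w) {c : ℝ} (hc : 0 < c) (hcw : ∀ t, c ≤ w t)
  (h : HasJumpLaw G ℓ w P Y T)

/-- The event that at the time of the `n`-th jump `s` has the smallest local time in `U`, that this
local time is at least `K`, and that it is at most the local time of `u` times `ε`. -/
def imbalanceEvent (ℓ : V → ℝ) (Y : ℕ → Ω → V) (T : ℕ → Ω → ℝ≥0∞) (U : Set V) (ε K : ℝ) (s u : V)
    (n : ℕ) : Set Ω :=
  {ω | K ≤ chainLocalTime ℓ Y T n ω s ∧ chainLocalTime ℓ Y T n ω s ≤ ε * chainLocalTime ℓ Y T n ω u ∧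
    ∀ v ∈ U, chainLocalTime ℓ Y T n ω s ≤ chainLocalTime ℓ Y T n ω v}

omit [Nontrivial V] [MeasurableSpace Ω] in
lemma measurableSet_imbalanceEvent (U : Set V) (ε K : ℝ) (s u : V) (n : ℕ) :
    MeasurableSet[past Y T n] (imbalanceEvent ℓ Y T U ε K s u n) := by
  have h := measurable_chainLocalTime_past ℓ Y T n
  have e : imbalanceEvent ℓ Y T U ε K s u n = chainLocalTime ℓ Y T n ⁻¹'
      ({z | K ≤ z s} ∩ {z | z s ≤ ε * z u} ∩ ⋂ v ∈ U, {z | z s ≤ z v}) := by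
    ext ω
    simp [imbalanceEvent, and_assoc]
  have hu : Measurable fun z : V → ℝ => ε * z u := by fun_prop
  rw [e]
  refine h (((measurableSet_le measurable_const (measurable_pi_apply s)).inter
    (measurableSet_le (measurable_pi_apply s) hu)).inter
    (MeasurableSet.biInter (to_countable _) fun v _ =>
      measurableSet_le (measurable_pi_apply s) (measurable_pi_apply v)))

include hG hw hc hcw h

/-- When the local times in `U` are too unbalanced, the conditional probability that all of them
grow to infinity is at most one half. -/
lemma HasJumpLaw.condExp_localizationEvent_le {U : Set V} {M ε K : ℝ} {s u : V} (hsU : s ∈ U)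
    (hsu : (edgesMeeting G U).Reachable s u) (hfin : invMeasure w (Ioi (ℓ s)) ≠ ∞)
    (h0 : ∀ x, invMeasure w (Ioi x) ≠ 0)
    (hK : ∀ x y, K ≤ x → x ≤ ε * y → ENNReal.ofReal (comparisonConst V c (w M) / w x) +
      invMeasure w (Ioi y) ≤ 2⁻¹ * invMeasure w (Ioi x)) (n : ℕ) :
    ∀ᵐ ω ∂P, ω ∈ imbalanceEvent ℓ Y T U ε K s u n →
      P[((localizationEvent ℓ Y T U M).indicator 1 : Ω → ℝ) | past Y T n] ω ≤ 1 / 2 := by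
  set A := localizationEvent ℓ Y T U M
  set D := imbalanceEvent ℓ Y T U ε K s u n
  have hm := h.past_le n
  have hA : MeasurableSet A :=
    (iSup_le fun k => h.past_le k) _ (measurableSet_localizationEvent U M)
  have hD : MeasurableSet[past Y T n] D := measurableSet_imbalanceEvent U ε K s u n
  set H : Ω → ℝ≥0∞ := fun ω => invMeasure w (Ioi (chainLocalTime ℓ Y T n ω s)) with hH
  have hHm : Measurable[past Y T n] H := by
    have : Antitone fun x => invMeasure w (Ioi x) := fun x y hxy =>
      measure_mono (Ioi_subset_Ioi hxy)
    exact this.measurable.comp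
      ((measurable_pi_apply s).comp (measurable_chainLocalTime_past ℓ Y T n))
  have hHle : ∀ ω, H ω ≤ invMeasure w (Ioi (ℓ s)) := fun ω =>
    measure_mono (Ioi_subset_Ioi (le_chainLocalTime ℓ Y T n ω s))
  have hHtop : ∀ ω, H ω ≠ ∞ := fun ω => ne_top_of_le_ne_top hfin (hHle ω)
  have hHpos : ∀ ω, 0 < (H ω).toReal := fun ω => ENNReal.toReal_pos (h0 _) (hHtop ω)
  have hHr : Measurable[past Y T n] fun ω => (H ω).toReal := hHm.ennreal_toReal
  have hHr' : Measurable fun ω => (H ω).toReal := hHr.mono hm le_rfl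
  have hHint : Integrable (fun ω => (H ω).toReal) P := by
    refine Integrable.of_bound hHr'.aestronglyMeasurable (invMeasure w (Ioi (ℓ s))).toReal
      (Eventually.of_forall fun ω => ?_)
    rw [Real.norm_of_nonneg ENNReal.toReal_nonneg]
    exact ENNReal.toReal_mono hfin (hHle ω)
  set f : Ω → ℝ := A.indicator 1 with hf
  have hfint : Integrable f P := (integrable_const (1 : ℝ)).indicator hA
  set g := P[f | past Y T n] with hg
  have hHf : (fun ω => (H ω).toReal) * f = A.indicator fun ω => (H ω).toReal := by
    funext ω
    by_cases hω : ω ∈ A <;> simp [hf, hω]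
  have hHfint : Integrable ((fun ω => (H ω).toReal) * f) P := by
    rw [hHf]
    exact hHint.indicator hA
  have hpull := condExp_mul_of_stronglyMeasurable_left hHr.stronglyMeasurable hHfint hfint
  have hHgint : Integrable (fun ω => (H ω).toReal * g ω) P := integrable_condExp.congr hpull
  set F := D ∩ {ω | 1 / 2 < g ω} with hF
  have hgm : Measurable[past Y T n] g := stronglyMeasurable_condExp.measurable
  have hFm : MeasurableSet[past Y T n] F := MeasurableSet.inter hD (measurableSet_lt measurable_const hgm)
  have hF' : MeasurableSet F := hm _ hFm
  have hle : ∫⁻ ω in F ∩ A, H ω ∂P ≤ 2⁻¹ * ∫⁻ ω in F, H ω ∂P := by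
    refine (h.setLIntegral_invMeasure_Ioi_le hG hw hc hcw hsU hsu n hFm
      fun ω hω => hω.1.2.2).trans ?_
    rw [← lintegral_const_mul' _ _ (by simp)]
    exact setLIntegral_mono' hF' fun ω hω => hK _ _ hω.1.1 hω.1.2.1
  have htop : ∀ S : Set Ω, ∫⁻ ω in S, H ω ∂P ≠ ∞ := by
    intro S
    refine ne_top_of_le_ne_top ?_ ((lintegral_mono hHle).trans (le_of_eq (lintegral_const _)))
    exact ENNReal.mul_ne_top hfin (measure_ne_top _ _)
  have hreal : ∀ S : Set Ω, ∫ ω in S, (H ω).toReal ∂P = (∫⁻ ω in S, H ω ∂P).toReal := fun S =>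
    integral_toReal (hHm.mono hm le_rfl).aemeasurable
      (Eventually.of_forall fun ω => (hHtop ω).lt_top)
  have hle' : ∫ ω in F, (H ω).toReal * g ω ∂P ≤ 1 / 2 * ∫ ω in F, (H ω).toReal ∂P := by
    have e1 : ∫ ω in F, (H ω).toReal * g ω ∂P = ∫ ω in F ∩ A, (H ω).toReal ∂P := by
      calc _ = ∫ ω in F, (P[(fun ω => (H ω).toReal) * f | past Y T n]) ω ∂P :=
            (integral_congr_ae (ae_restrict_of_ae hpull)).symm
        _ = ∫ ω in F, ((fun ω => (H ω).toReal) * f) ω ∂P := setIntegral_condExp hm hHfint hFm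
        _ = _ := by rw [hHf, setIntegral_indicator hA]
    rw [e1, hreal, hreal]
    have := ENNReal.toReal_mono (ENNReal.mul_ne_top (by simp) (htop F)) hle
    rw [ENNReal.toReal_mul] at this
    simpa using this
  have hzero : ∫ ω in F, (H ω).toReal * (g ω - 1 / 2) ∂P ≤ 0 := by
    have : ∀ ω, (H ω).toReal * (g ω - 1 / 2) = (H ω).toReal * g ω - 1 / 2 * (H ω).toReal :=
      fun ω => by ring
    simp only [this]
    rw [integral_sub hHgint.integrableOn (hHint.const_mul _).integrableOn, integral_const_mul]
    linarith
  have hnull : P F = 0 := by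
    have hnn : 0 ≤ᵐ[P.restrict F] fun ω => (H ω).toReal * (g ω - 1 / 2) := by
      filter_upwards [ae_restrict_mem hF'] with ω hω
      exact mul_nonneg (hHpos ω).le (sub_nonneg.2 (le_of_lt hω.2))
    have hi : IntegrableOn (fun ω => (H ω).toReal * (g ω - 1 / 2)) F P := by
      have : (fun ω => (H ω).toReal * (g ω - 1 / 2)) =
          (fun ω => (H ω).toReal * g ω) - fun ω => 1 / 2 * (H ω).toReal := by
        funext ω
        simp only [Pi.sub_apply]
        ring
      rw [this]
      exact (hHgint.sub (hHint.const_mul _)).integrableOn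
    by_contra hP
    have hpos' := (setIntegral_pos_iff_support_of_nonneg_ae hnn hi).2 (by
      refine (pos_iff_ne_zero.2 hP).trans_le (measure_mono fun ω hω => ⟨?_, hω⟩)
      exact (mul_pos (hHpos ω) (sub_pos.2 hω.2)).ne')
    linarith
  filter_upwards [measure_eq_zero_iff_ae_notMem.1 hnull] with ω hω hωD
  by_contra! hlt
  exact hω ⟨hωD, hlt⟩

/-- By Lévy's zero-one law, the local times that grow to infinity are unbalanced only finitely
often. -/
lemma HasJumpLaw.ae_eventually_notMem_imbalanceEvent {U : Set V} {M ε K : ℝ} {s u : V}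
    (hsU : s ∈ U) (hsu : (edgesMeeting G U).Reachable s u) (hfin : invMeasure w (Ioi (ℓ s)) ≠ ∞)
    (h0 : ∀ x, invMeasure w (Ioi x) ≠ 0)
    (hK : ∀ x y, K ≤ x → x ≤ ε * y → ENNReal.ofReal (comparisonConst V c (w M) / w x) +
      invMeasure w (Ioi y) ≤ 2⁻¹ * invMeasure w (Ioi x)) :
    ∀ᵐ ω ∂P, ω ∈ localizationEvent ℓ Y T U M →
      ∀ᶠ n in atTop, ω ∉ imbalanceEvent ℓ Y T U ε K s u n := by
  set A := localizationEvent ℓ Y T U M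
  let ℱ : Filtration ℕ (inferInstance : MeasurableSpace Ω) :=
    { seq := past Y T, mono' := past_mono Y T, le' := h.past_le }
  have hA : MeasurableSet[⨆ n, ℱ n] A := measurableSet_localizationEvent U M
  have hA' : MeasurableSet A := (iSup_le fun k => h.past_le k) _ hA
  have hint : Integrable (A.indicator 1 : Ω → ℝ) P := (integrable_const (1 : ℝ)).indicator hA'
  have hlevy := hint.tendsto_ae_condExp (ℱ := ℱ)
    (StronglyMeasurable.indicator stronglyMeasurable_one hA)
  filter_upwards [hlevy, ae_all_iff.2 fun n =>
    h.condExp_localizationEvent_le hG hw hc hcw (M := M) hsU hsu hfin h0 hK n] with ω h1 h2 hωA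
  rw [indicator_of_mem hωA, Pi.one_apply] at h1
  filter_upwards [h1.eventually_const_lt (show (1 / 2 : ℝ) < 1 by norm_num)] with n hn hD
  exact (h2 n hD).not_gt hn

/-- The local times that grow to infinity are comparable. -/
lemma HasJumpLaw.ae_comparable {ε : ℝ}
    (hfin : ∀ v, invMeasure w (Ioi (ℓ v)) ≠ ∞) (h0 : ∀ x, invMeasure w (Ioi x) ≠ 0)
    (hε : ∀ C : ℝ, 0 ≤ C → ∃ K : ℝ, ∀ x y, K ≤ x → x ≤ ε * y →
      ENNReal.ofReal (C / w x) + invMeasure w (Ioi y) ≤ 2⁻¹ * invMeasure w (Ioi x)) :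
    ∀ᵐ ω ∂P, ∀ (U : Set V) (M : ℕ), ω ∈ localizationEvent ℓ Y T U M →
      ∀ᶠ n in atTop, ∀ s ∈ U, ∀ u ∈ U,
        ε * chainLocalTime ℓ Y T n ω u < chainLocalTime ℓ Y T n ω s := by
  have hpos : ∀ t, 0 < w t := fun t => hc.trans_le (hcw t)
  rw [ae_all_iff]
  intro U
  rw [ae_all_iff]
  intro M
  by_cases hconn : ∀ s ∈ U, ∀ u ∈ U, (edgesMeeting G U).Reachable s u
  swap
  · filter_upwards [h.ae_reachable hG hw hpos hfin U M] with ω hω hA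
    exact absurd (hω hA) hconn
  have hC : 0 ≤ comparisonConst V c (w M) := by
    have := hpos M
    unfold comparisonConst
    positivity
  obtain ⟨K, hK⟩ := hε _ hC
  have hall : ∀ᵐ ω ∂P, ∀ s u : V, s ∈ U → u ∈ U → ω ∈ localizationEvent ℓ Y T U M →
      ∀ᶠ n in atTop, ω ∉ imbalanceEvent ℓ Y T U ε K s u n := by
    rw [ae_all_iff]
    intro s
    rw [ae_all_iff]
    intro u
    by_cases hs : s ∈ U
    · by_cases hu : u ∈ U
      · filter_upwards [h.ae_eventually_notMem_imbalanceEvent hG hw hc hcw (M := M) hs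
          (hconn s hs u hu) (hfin s) h0 hK] with ω hω _ _ using hω
      · exact Eventually.of_forall fun ω _ h => absurd h hu
    · exact Eventually.of_forall fun ω h => absurd h hs
  filter_upwards [hall] with ω hω hA
  have h1 : ∀ᶠ n in atTop, ∀ s u : V, s ∈ U → u ∈ U → ω ∉ imbalanceEvent ℓ Y T U ε K s u n := by
    rw [eventually_all]
    intro s
    rw [eventually_all]
    intro u
    by_cases hs : s ∈ U
    · by_cases hu : u ∈ U
      · filter_upwards [hω s u hs hu hA] with n hn _ _ using hn
      · exact Eventually.of_forall fun n _ h => absurd h hu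
    · exact Eventually.of_forall fun n h => absurd h hs
  have h2 : ∀ᶠ n in atTop, ∀ s : V, s ∈ U → K ≤ chainLocalTime ℓ Y T n ω s := by
    rw [eventually_all]
    intro s
    by_cases hs : s ∈ U
    · filter_upwards [(localizationEvent_tendsto hA hs).eventually_ge_atTop K] with n hn _ using hn
    · exact Eventually.of_forall fun n h => absurd h hs
  filter_upwards [h1, h2] with n hn1 hn2 s hs u hu
  obtain ⟨s₀, hs₀, hmin⟩ := (toFinite U).exists_minimalFor (chainLocalTime ℓ Y T n ω) U ⟨s, hs⟩
  have hmin' : ∀ v ∈ U, chainLocalTime ℓ Y T n ω s₀ ≤ chainLocalTime ℓ Y T n ω v := by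
    intro v hv
    rcases le_total (chainLocalTime ℓ Y T n ω s₀) (chainLocalTime ℓ Y T n ω v) with hle | hle
    · exact hle
    · exact hmin hv hle
  by_contra! hcon
  exact hn1 s₀ u hs₀ hu ⟨hn2 s₀ hs₀, (hmin' s hs).trans hcon, hmin'⟩

end Levy

/-! ### From the jump chain to the process -/

section Paths

variable {V : Type*} {ℓ : V → ℝ} {x : ℝ≥0 → V} {y : ℕ → V} {T : ℕ → ℝ≥0∞}

lemma toReal_jumpTime_succ (hT : ∀ n, T n ≠ ∞) (n : ℕ) :
    (jumpTime T (n + 1)).toReal = (jumpTime T n).toReal + (T n).toReal := by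
  rw [jumpTime, jumpTime, Finset.sum_range_succ,
    ENNReal.toReal_add (ENNReal.sum_ne_top.2 fun k _ => hT k) (hT n)]

lemma jumpTime_mono (T : ℕ → ℝ≥0∞) : Monotone (jumpTime T) := fun _ _ h =>
  Finset.sum_le_sum_of_subset (Finset.range_mono h)

lemma jumpTime_ne_top (hT : ∀ n, T n ≠ ∞) (n : ℕ) : jumpTime T n ≠ ∞ :=
  ENNReal.sum_ne_top.2 fun k _ => hT k

variable (hT : ∀ n, T n ≠ ∞) (hcover : ∀ t : ℝ≥0, ∃ n, jumpTime T n ≤ t ∧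
  (t : ℝ≥0∞) < jumpTime T (n + 1) ∧ x t = y n)
include hT hcover

lemma path_eq_of_mem_Ico {n : ℕ} {s : ℝ}
    (hs : s ∈ Ico (jumpTime T n).toReal (jumpTime T (n + 1)).toReal) : x s.toNNReal = y n := by
  have hs0 : 0 ≤ s := ENNReal.toReal_nonneg.trans hs.1
  obtain ⟨m, hm1, hm2, hm3⟩ := hcover s.toNNReal
  have h1 : jumpTime T n ≤ (s.toNNReal : ℝ≥0∞) := by
    rw [← ENNReal.ofReal_toReal (jumpTime_ne_top hT n)]
    exact ENNReal.ofReal_le_ofReal hs.1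
  have h2 : (s.toNNReal : ℝ≥0∞) < jumpTime T (n + 1) := by
    rw [← ENNReal.ofReal_toReal (jumpTime_ne_top hT (n + 1))]
    exact (ENNReal.ofReal_lt_ofReal_iff (hs0.trans_lt hs.2)).2 hs.2
  have h3 : m < n + 1 := (jumpTime_mono T).reflect_lt (hm1.trans_lt h2)
  have h4 : n < m + 1 := (jumpTime_mono T).reflect_lt (h1.trans_lt hm2)
  rw [hm3, show m = n by omega]

lemma integral_path_Ico (v : V) {n : ℕ} {t : ℝ}
    (ht : t ∈ Icc (jumpTime T n).toReal (jumpTime T (n + 1)).toReal) :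
    IntervalIntegrable ({s : ℝ | x s.toNNReal = v}.indicator (1 : ℝ → ℝ)) volume
        (jumpTime T n).toReal t ∧
      ∫ s in (jumpTime T n).toReal..t, {s : ℝ | x s.toNNReal = v}.indicator (1 : ℝ → ℝ) s =
        if y n = v then t - (jumpTime T n).toReal else 0 := by
  have hconst : ∀ s ∈ Ioo (jumpTime T n).toReal t,
      {s : ℝ | x s.toNNReal = v}.indicator (1 : ℝ → ℝ) s = if y n = v then 1 else 0 := by
    intro s hs
    have := path_eq_of_mem_Ico hT hcover (n := n) (s := s) ⟨hs.1.le, hs.2.trans_le ht.2⟩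
    simp only [indicator, mem_ofPred_eq, this, Pi.one_apply]
  have hae : (fun _ => if y n = v then (1 : ℝ) else 0) =ᵐ[volume.restrict
      (Ioc (jumpTime T n).toReal t)] {s : ℝ | x s.toNNReal = v}.indicator (1 : ℝ → ℝ) := by
    rw [← restrict_Ioo_eq_restrict_Ioc]
    filter_upwards [ae_restrict_mem measurableSet_Ioo] with s hs
    exact (hconst s hs).symm
  constructor
  · rw [intervalIntegrable_iff_integrableOn_Ioc_of_le ht.1]
    exact Integrable.congr (integrableOn_const (by simp)) hae
  · rw [intervalIntegral.integral_of_le ht.1, ← integral_congr_ae hae,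
      ← intervalIntegral.integral_of_le ht.1, intervalIntegral.integral_const]
    split_ifs <;> simp

lemma integral_path_jumpTime (v : V) (n : ℕ) :
    IntervalIntegrable ({s : ℝ | x s.toNNReal = v}.indicator (1 : ℝ → ℝ)) volume 0
        (jumpTime T n).toReal ∧
      ℓ v + ∫ s in (0 : ℝ)..(jumpTime T n).toReal,
        {s : ℝ | x s.toNNReal = v}.indicator (1 : ℝ → ℝ) s = jumpLocalTime ℓ y T n v := by
  induction n with
  | zero => simp [jumpTime, jumpLocalTime]
  | succ n ih =>
    have hle : (jumpTime T n).toReal ≤ (jumpTime T (n + 1)).toReal := by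
      rw [toReal_jumpTime_succ hT]
      exact le_add_of_nonneg_right ENNReal.toReal_nonneg
    have h := integral_path_Ico hT hcover v (n := n) (right_mem_Icc.2 hle)
    refine ⟨ih.1.trans h.1, ?_⟩
    rw [← intervalIntegral.integral_add_adjacent_intervals ih.1 h.1, ← add_assoc, ih.2, h.2,
      toReal_jumpTime_succ hT, add_sub_cancel_left, jumpLocalTime, jumpLocalTime,
      Finset.sum_range_succ, add_assoc]

/-- The local times between the `n`-th and the `(n+1)`-st jump. -/
lemma localTime_eq (v : V) {n : ℕ} {t : ℝ≥0}
    (ht : (t : ℝ) ∈ Icc (jumpTime T n).toReal (jumpTime T (n + 1)).toReal) :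
    localTime ℓ x v t =
      jumpLocalTime ℓ y T n v + if y n = v then t - (jumpTime T n).toReal else 0 := by
  have h1 := integral_path_jumpTime (ℓ := ℓ) hT hcover v n
  have h2 := integral_path_Ico hT hcover v ht
  rw [localTime, ← intervalIntegral.integral_add_adjacent_intervals h1.1 h2.1, ← add_assoc, h1.2,
    h2.2]

lemma exists_mem_Ico (t : ℝ≥0) : ∃ n, (t : ℝ) ∈
    Ico (jumpTime T n).toReal (jumpTime T (n + 1)).toReal := by
  obtain ⟨n, h1, h2, -⟩ := hcover t
  refine ⟨n, ?_, ?_⟩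
  · simpa using ENNReal.toReal_mono ENNReal.coe_ne_top h1
  · simpa using (ENNReal.toReal_lt_toReal ENNReal.coe_ne_top (jumpTime_ne_top hT _)).2 h2

lemma jumpLocalTime_le_localTime (v : V) {n : ℕ} {t : ℝ≥0}
    (ht : (t : ℝ) ∈ Icc (jumpTime T n).toReal (jumpTime T (n + 1)).toReal) :
    jumpLocalTime ℓ y T n v ≤ localTime ℓ x v t := by
  rw [localTime_eq hT hcover v ht]
  refine le_add_of_nonneg_right ?_
  split_ifs
  · exact sub_nonneg.2 ht.1
  · exact le_rfl

lemma localTime_le_jumpLocalTime (v : V) {n : ℕ} {t : ℝ≥0}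
    (ht : (t : ℝ) ∈ Icc (jumpTime T n).toReal (jumpTime T (n + 1)).toReal) :
    localTime ℓ x v t ≤ jumpLocalTime ℓ y T (n + 1) v := by
  rw [localTime_eq hT hcover v ht, jumpLocalTime, jumpLocalTime, Finset.sum_range_succ, ← add_assoc]
  refine add_le_add le_rfl ?_
  split_ifs
  · have := ht.2
    rw [toReal_jumpTime_succ hT] at this
    linarith
  · exact le_rfl

omit hcover hT in
lemma jumpLocalTime_mono (ℓ : V → ℝ) (y : ℕ → V) (T : ℕ → ℝ≥0∞) (v : V) :
    Monotone fun n => jumpLocalTime ℓ y T n v :=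
  chainLocalTime_mono ℓ (fun n (_ : Unit) => y n) (fun n _ => T n) () v

lemma eventually_exists_mem_Ico (N : ℕ) : ∀ᶠ t : ℝ≥0 in atTop, ∃ n, N ≤ n ∧ (t : ℝ) ∈
    Ico (jumpTime T n).toReal (jumpTime T (n + 1)).toReal := by
  filter_upwards [eventually_ge_atTop (jumpTime T N).toNNReal] with t ht
  obtain ⟨n, hn⟩ := exists_mem_Ico hT hcover t
  refine ⟨n, ?_, hn⟩
  by_contra! hlt
  have h1 : (jumpTime T (n + 1)).toReal ≤ (jumpTime T N).toReal :=
    ENNReal.toReal_mono (jumpTime_ne_top hT N) (jumpTime_mono T hlt)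
  have h2 : (jumpTime T N).toReal ≤ t := NNReal.coe_le_coe.2 ht
  linarith [hn.2]

lemma exists_le_jumpLocalTime {v : V} (hv : v ∈ unboundedVertices ℓ x) (K : ℝ) :
    ∃ n, K ≤ jumpLocalTime ℓ y T n v := by
  have hv : Tendsto (localTime ℓ x v) atTop atTop := hv
  obtain ⟨t, ht⟩ := (hv.eventually_ge_atTop K).exists
  obtain ⟨n, hn⟩ := exists_mem_Ico hT hcover t
  exact ⟨n + 1, ht.trans (localTime_le_jumpLocalTime hT hcover v (Ico_subset_Icc_self hn))⟩

lemma exists_jumpLocalTime_le {v : V} (hv : v ∉ unboundedVertices ℓ x) :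
    ∃ M : ℝ, ∀ n, jumpLocalTime ℓ y T n v ≤ M := by
  by_contra! hcon
  refine hv (tendsto_atTop.2 fun K => ?_)
  obtain ⟨N, hN⟩ := hcon K
  filter_upwards [eventually_exists_mem_Ico hT hcover N] with t ⟨n, hn, ht⟩
  exact hN.le.trans ((jumpLocalTime_mono ℓ y T v hn).trans
    (jumpLocalTime_le_localTime hT hcover v (Ico_subset_Icc_self ht)))

variable [Fintype V]

lemma exists_nat_jumpLocalTime_le :
    ∃ M : ℕ, ∀ n, ∀ b ∉ unboundedVertices ℓ x, jumpLocalTime ℓ y T n b ≤ M := by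
  have h : ∀ b : V, ∃ M : ℝ, b ∉ unboundedVertices ℓ x → ∀ n, jumpLocalTime ℓ y T n b ≤ M := by
    intro b
    by_cases hb : b ∈ unboundedVertices ℓ x
    · exact ⟨0, fun h => absurd hb h⟩
    · obtain ⟨M, hM⟩ := exists_jumpLocalTime_le (ℓ := ℓ) hT hcover hb
      exact ⟨M, fun _ => hM⟩
  choose M hM using h
  obtain ⟨B, hB⟩ := (finite_range M).bddAbove
  obtain ⟨K, hK⟩ := exists_nat_ge B
  exact ⟨K, fun n b hb => (hM b hb n).trans ((hB (mem_range_self b)).trans hK)⟩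

/-- The total time is the sum of the local times, so that at least one of them is unbounded. -/
lemma unboundedVertices_nonempty : (unboundedVertices ℓ x).Nonempty := by
  by_contra hcon
  rw [not_nonempty_iff_eq_empty] at hcon
  obtain ⟨M, hM⟩ := exists_nat_jumpLocalTime_le (ℓ := ℓ) hT hcover
  have hsum : ∀ n, ∑ v, jumpLocalTime ℓ y T n v = ∑ v, ℓ v + (jumpTime T n).toReal := by
    intro n
    simp only [jumpLocalTime]
    rw [Finset.sum_add_distrib, Finset.sum_comm, jumpTime, ENNReal.toReal_sum fun k _ => hT k]
    congr 1
    refine Finset.sum_congr rfl fun k _ => ?_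
    rw [Finset.sum_ite_eq Finset.univ (y k), if_pos (Finset.mem_univ _)]
  set R : ℝ := ∑ _v : V, (M : ℝ) - ∑ v, ℓ v
  obtain ⟨n, hn⟩ := exists_mem_Ico hT hcover R.toNNReal
  have h1 : ∑ v, jumpLocalTime ℓ y T (n + 1) v ≤ ∑ _v : V, (M : ℝ) :=
    Finset.sum_le_sum fun v _ => hM (n + 1) v (by simp [hcon])
  rw [hsum] at h1
  have h2 := hn.2
  have h3 : R ≤ R.toNNReal := Real.le_coe_toNNReal R
  linarith

omit [Fintype V] in
/-- Comparability of the local times at the jump times implies comparability at all times: between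
two jumps only one of the local times changes. -/
lemma eventually_mul_localTime_le {U : Set V} {ε : ℝ} (hε0 : 0 ≤ ε) (hε1 : ε ≤ 1)
    (hℓ : ∀ v, 0 < ℓ v)
    (h : ∀ᶠ n in atTop, ∀ s ∈ U, ∀ u ∈ U, ε * jumpLocalTime ℓ y T n u < jumpLocalTime ℓ y T n s) :
    ∀ᶠ t : ℝ≥0 in atTop, ∀ s ∈ U, ∀ u ∈ U, ε * localTime ℓ x u t ≤ localTime ℓ x s t := by
  obtain ⟨N, hN⟩ := eventually_atTop.1 h
  filter_upwards [eventually_exists_mem_Ico hT hcover N] with t ⟨n, hn, ht⟩ s hs u hu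
  have ht' := Ico_subset_Icc_self ht
  have hs1 := jumpLocalTime_le_localTime (ℓ := ℓ) hT hcover s ht'
  by_cases huy : y n = u
  · by_cases hsy : y n = s
    · have hsu : s = u := hsy.symm.trans huy
      subst hsu
      have h0 : 0 ≤ localTime ℓ x s t := by
        have := jumpLocalTime_mono ℓ y T s (Nat.zero_le n)
        simp only [jumpLocalTime, Finset.range_zero, Finset.sum_empty, add_zero] at this
        exact (hℓ s).le.trans (this.trans hs1)
      nlinarith
    · have h1 := hN (n + 1) (hn.trans n.le_succ) s hs u hu
      have h2 := localTime_le_jumpLocalTime (ℓ := ℓ) hT hcover u ht'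
      have h3 : jumpLocalTime ℓ y T (n + 1) s = jumpLocalTime ℓ y T n s := by
        simp [jumpLocalTime, Finset.sum_range_succ, hsy]
      have h4 := mul_le_mul_of_nonneg_left h2 hε0
      linarith
  · have h1 := hN n hn s hs u hu
    have h2 : localTime ℓ x u t = jumpLocalTime ℓ y T n u := by
      rw [localTime_eq hT hcover u ht', if_neg huy, add_zero]
    rw [h2]
    exact h1.le.trans hs1

end Paths

section Clusters

variable {V : Type*} [Fintype V]

omit [Fintype V] in
lemma localTime_pos {ℓ : V → ℝ} (hℓ : ∀ v, 0 < ℓ v) (x : ℝ≥0 → V) (v : V) (t : ℝ≥0) :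
    0 < localTime ℓ x v t :=
  add_pos_of_pos_of_nonneg (hℓ v) (intervalIntegral.integral_nonneg t.2 fun s _ =>
    indicator_nonneg (fun _ _ => zero_le_one) s)

/-- If the local times on `V*` are comparable, so are those of the clusters. -/
lemma liminf_cluster_pos (G : SimpleGraph V) {ℓ : V → ℝ} (hℓ : ∀ v, 0 < ℓ v) {x : ℝ≥0 → V}
    (hne : (unboundedVertices ℓ x).Nonempty) {ε : ℝ} (hε : 0 < ε)
    (h : ∀ᶠ t : ℝ≥0 in atTop, ∀ s ∈ unboundedVertices ℓ x, ∀ u ∈ unboundedVertices ℓ x,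
      ε * localTime ℓ x u t ≤ localTime ℓ x s t) :
    0 < liminf (fun t : ℝ≥0 => smallestClusterLocalTime G ℓ x t /
      largestClusterLocalTime G ℓ x t) atTop := by
  obtain ⟨v₀, hv₀⟩ := hne
  have hCne : Nonempty (Cluster G ℓ x) :=
    ⟨(G.induce (unboundedVertices ℓ x)).connectedComponentMk ⟨v₀, hv₀⟩⟩
  have hCfin : Finite (Cluster G ℓ x) := Quot.finite _
  have hcard : (0 : ℝ) < Fintype.card V := Nat.cast_pos.2 (Fintype.card_pos_iff.2 ⟨v₀⟩)
  have hle : ∀ (C : Cluster G ℓ x) (s : unboundedVertices ℓ x), s ∈ C.supp → ∀ t,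
      localTime ℓ x s t ≤ clusterLocalTime G ℓ x C t := by
    intro C s hs t
    have h1 : (Subtype.val '' C.supp).indicator (fun v => localTime ℓ x v t) (s : V) =
        localTime ℓ x s t := indicator_of_mem (mem_image_of_mem _ hs) _
    rw [← h1]
    exact Finset.single_le_sum
      (f := (Subtype.val '' C.supp).indicator fun v => localTime ℓ x v t)
      (fun v _ => indicator_nonneg (fun v _ => (localTime_pos hℓ x v t).le) v) (Finset.mem_univ _)
  have hCpos : ∀ (C : Cluster G ℓ x) t, 0 < clusterLocalTime G ℓ x C t := by
    intro C t
    obtain ⟨s, hs⟩ := C.nonempty_supp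
    exact (localTime_pos hℓ x s t).trans_le (hle C s hs t)
  have hbdd : ∀ t, BddAbove (range fun C : Cluster G ℓ x => clusterLocalTime G ℓ x C t) := fun t =>
    (finite_range _).bddAbove
  have hbdd' : ∀ t, BddBelow (range fun C : Cluster G ℓ x => clusterLocalTime G ℓ x C t) := fun t =>
    (finite_range _).bddBelow
  have hlarge : ∀ t, 0 < largestClusterLocalTime G ℓ x t := fun t =>
    (hCpos hCne.some t).trans_le (le_ciSup (hbdd t) _)
  have hone : ∀ t, smallestClusterLocalTime G ℓ x t / largestClusterLocalTime G ℓ x t ≤ 1 :=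
    fun t => (div_le_one (hlarge t)).2 ((ciInf_le (hbdd' t) hCne.some).trans (le_ciSup (hbdd t) _))
  refine (div_pos hε hcard).trans_le (le_liminf_of_le ?_ ?_)
  · exact isCoboundedUnder_ge_of_le atTop hone
  · filter_upwards [h] with t ht
    rw [div_le_div_iff₀ hcard (hlarge t)]
    have h1 : ∀ C D : Cluster G ℓ x, ε * clusterLocalTime G ℓ x D t ≤
        Fintype.card V * clusterLocalTime G ℓ x C t := by
      intro C D
      obtain ⟨s, hs⟩ := C.nonempty_supp
      rw [clusterLocalTime, setLocalTime, Finset.mul_sum, ← Finset.card_univ, ← nsmul_eq_mul,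
        ← Finset.sum_const]
      refine Finset.sum_le_sum fun u _ => ?_
      by_cases hu : u ∈ Subtype.val '' D.supp
      · rw [indicator_of_mem hu]
        obtain ⟨u', -, rfl⟩ := hu
        exact (ht s s.2 u' u'.2).trans (hle C s hs t)
      · rw [indicator_of_notMem hu, mul_zero]
        exact (hCpos C t).le
    have h2 : ∀ C : Cluster G ℓ x, ε * largestClusterLocalTime G ℓ x t ≤
        Fintype.card V * clusterLocalTime G ℓ x C t := by
      intro C
      rw [mul_comm, ← le_div_iff₀ hε]
      exact ciSup_le fun D => by
        rw [le_div_iff₀ hε, mul_comm]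
        exact h1 C D
    rw [← div_le_iff₀ hcard]
    refine le_ciInf fun C => ?_
    rw [div_le_iff₀ hcard, mul_comm _ (Fintype.card V : ℝ)]
    exact h2 C

end Clusters

section Truncation

variable {V : Type*} [Fintype V]

omit [Fintype V] in
lemma jumpRate_congr (G : SimpleGraph V) {w w' : ℝ → ℝ} {z : V → ℝ} (hz : ∀ v, w (z v) = w' (z v))
    (i j : V) : jumpRate G w z i j = jumpRate G w' z i j := by
  simp only [jumpRate, hz]

/-- A vertex-reinforced jump process only depends on the values of `w` above the initial local
times. -/
lemma IsVRJP.exists_hasJumpLaw {Ω : Type*} [MeasurableSpace Ω] [MeasurableSpace V]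
    {G : SimpleGraph V} {ℓ : V → ℝ} {w w' : ℝ → ℝ} {P : Measure Ω} {X : ℝ≥0 → Ω → V}
    (hX : IsVRJP G ℓ w P X) (hww' : ∀ t, (⨅ v, ℓ v) ≤ t → w t = w' t) :
    ∃ (Y : ℕ → Ω → V) (T : ℕ → Ω → ℝ≥0∞), HasJumpLaw G ℓ w' P Y T ∧
      ∀ᵐ ω ∂P, ∀ t : ℝ≥0, ∃ n, jumpTime (fun k => T k ω) n ≤ t ∧
        (t : ℝ≥0∞) < jumpTime (fun k => T k ω) (n + 1) ∧ X t ω = Y n ω := by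
  obtain ⟨Y, T, hY, hT, hcover, hlaw⟩ := hX.exists_jumps
  refine ⟨Y, T, ⟨hY, hT, fun n j s => (hlaw n j s).trans (ae_of_all _ fun ω => ?_)⟩, hcover⟩
  have hz : ∀ v, w (chainLocalTime ℓ Y T n ω v) = w' (chainLocalTime ℓ Y T n ω v) := fun v =>
    hww' _ ((ciInf_le (finite_range ℓ).bddBelow v).trans (le_chainLocalTime ℓ Y T n ω v))
  have hr := jumpRate_congr G hz (Y n ω)
  have hR : exitRate G w (chainLocalTime ℓ Y T n ω) (Y n ω) =
      exitRate G w' (chainLocalTime ℓ Y T n ω) (Y n ω) := Finset.sum_congr rfl fun j _ => hr j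
  change ∫ u in (0 : ℝ)..s, jumpRate G w (chainLocalTime ℓ Y T n ω) (Y n ω) j *
    Real.exp (-exitRate G w (chainLocalTime ℓ Y T n ω) (Y n ω) * u) = _
  rw [hr, hR]

end Truncation

end VRJP

end

theorem proposition5p8 {V : Type*} [Fintype V] [MeasurableSpace V] [MeasurableSingletonClass V]
    (G : SimpleGraph V) (hG : G.Connected)
    (ℓ : V → ℝ) (hℓ : ∀ v, 0 < ℓ v)
    (w : ℝ → ℝ) (hw_mono : MonotoneOn w (Set.Ici (⨅ v, ℓ v)))
    (hw_diff : DifferentiableOn ℝ w (Set.Ici (⨅ v, ℓ v)))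
    (κ α : ℝ) (hκ : 1 < κ) (hα : 1 < α)
    (hw : ∀ t, (⨅ v, ℓ v) ≤ t → κ⁻¹ * t ^ α ≤ w t ∧ w t ≤ κ * t ^ α)
    {Ω : Type*} [MeasurableSpace Ω] (P : MeasureTheory.Measure Ω)
    [MeasureTheory.IsProbabilityMeasure P]
    (X : NNReal → Ω → V) (hX : VRJP.IsVRJP G ℓ w P X) :
    ∀ᵐ ω ∂P, 0 < Filter.liminf (fun t : NNReal =>
      VRJP.smallestClusterLocalTime G ℓ (fun s => X s ω) t /
        VRJP.largestClusterLocalTime G ℓ (fun s => X s ω) t) Filter.atTop := by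
  have hVne : Nonempty V := hG.nonempty
  rcases subsingleton_or_nontrivial V with hV | hV
  · refine ae_of_all _ fun ω => ?_
    have hL : ∀ v t, VRJP.localTime ℓ (fun s => X s ω) v t = ℓ v + t := by
      intro v t
      have : {s : ℝ | X s.toNNReal ω = v} = univ := by
        ext s
        simp [Subsingleton.elim (X s.toNNReal ω) v]
      simp [VRJP.localTime, this]
    have hne : (VRJP.unboundedVertices ℓ fun s => X s ω).Nonempty := by
      refine ⟨hVne.some, ?_⟩
      change Tendsto _ _ _
      rw [funext (hL _)]
      exact tendsto_atTop_add_const_left _ _ (NNReal.tendsto_coe_atTop.2 tendsto_id)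
    refine VRJP.liminf_cluster_pos G hℓ hne one_pos (Eventually.of_forall fun t s _ u _ => ?_)
    rw [one_mul, Subsingleton.elim u s]
  set a := ⨅ v, ℓ v with ha
  have ha0 : 0 < a := by
    obtain ⟨v, hv⟩ := exists_eq_ciInf_of_finite (f := ℓ)
    rw [ha, ← hv]
    exact hℓ v
  -- Below `a` the values of `w` are irrelevant; the truncation makes `w` monotone everywhere.
  set w' : ℝ → ℝ := fun t => w (max t a) with hw'def
  have hw'eq : ∀ t, a ≤ t → w t = w' t := fun t ht => by simp only [hw'def, max_eq_left ht]
  have hw'mono : Monotone w' := fun s t hst =>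
    hw_mono (le_max_right s a) (le_max_right t a) (max_le_max_right a hst)
  have hκ0 : 0 < κ := one_pos.trans hκ
  have hc : 0 < κ⁻¹ * a ^ α := mul_pos (inv_pos.2 hκ0) (Real.rpow_pos_of_pos ha0 α)
  have hcw : ∀ t, κ⁻¹ * a ^ α ≤ w' t := fun t =>
    (hw a le_rfl).1.trans (hw_mono (self_mem_Ici) (le_max_right t a) (le_max_right t a))
  have hpos : ∀ t, 0 < w' t := fun t => hc.trans_le (hcw t)
  have hlow : ∀ t, a ≤ t → κ⁻¹ * t ^ α ≤ w' t := fun t ht => by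
    rw [← hw'eq t ht]
    exact (hw t ht).1
  have hup : ∀ t, a ≤ t → w' t ≤ κ * t ^ α := fun t ht => by
    rw [← hw'eq t ht]
    exact (hw t ht).2
  have hfin : ∀ v, VRJP.invMeasure w' (Ioi (ℓ v)) ≠ ∞ := fun v => ne_top_of_le_ne_top
    ENNReal.ofReal_ne_top (VRJP.invMeasure_Ioi_le hκ0 hα ha0 hlow
      (ciInf_le (finite_range ℓ).bddBelow v))
  have h0 : ∀ x, VRJP.invMeasure w' (Ioi x) ≠ 0 := fun x => by
    have h1 := VRJP.le_invMeasure_Ioi hκ0 ha0 hw'mono hpos hup (le_max_right x a)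
    have h2 : (0 : ℝ) < (κ * 2 ^ α)⁻¹ * (max x a) ^ (1 - α) := by
      have := Real.rpow_pos_of_pos (ha0.trans_le (le_max_right x a)) (1 - α)
      positivity
    exact ((ENNReal.ofReal_pos.2 h2).trans_le (h1.trans (measure_mono
      (Ioi_subset_Ioi (le_max_left x a))))).ne'
  obtain ⟨ε, hε0, hε1, hε⟩ :=
    VRJP.exists_invMeasure_Ioi_le_half hκ0 hα ha0 hw'mono hpos hlow hup
  obtain ⟨Y, T, hlaw, hcover⟩ := hX.exists_hasJumpLaw hw'eq
  filter_upwards [hcover, ae_all_iff.2 (hlaw.ae_holding_ne_top hw'mono hpos hG),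
    hlaw.ae_comparable hG hw'mono hc hcw hfin h0 hε] with ω hcov hT hcomp
  obtain ⟨M, hM⟩ := VRJP.exists_nat_jumpLocalTime_le (ℓ := ℓ) (x := fun s => X s ω) hT hcov
  have hA : ω ∈ VRJP.localizationEvent ℓ Y T (VRJP.unboundedVertices ℓ fun s => X s ω) M :=
    ⟨fun n b hb => hM n b hb, fun v hv K => VRJP.exists_le_jumpLocalTime hT hcov hv K⟩
  exact VRJP.liminf_cluster_pos G hℓ (VRJP.unboundedVertices_nonempty hT hcov) hε0
    (VRJP.eventually_mul_localTime_le hT hcov hε0.le hε1 hℓ (hcomp _ M hA))
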